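/- Let $T$ be a tournament (a complete graph in which every edge is given exactly one of its two directions) on $k\ge 3$ vertices. In the $(1:b)$ $T$-tournament game on $K_n$, two players, Maker and Breaker, alternately claim free (previously unclaimed) edges of $K_n$, with Maker going first: in each round Maker claims one free edge and chooses one of its two orientations, and then Breaker claims $b$ free edges (all of them, if fewer than $b$ remain). When all edges are claimed, Maker wins if the directed graph formed by her edges contains a copy of $T$; otherwise Breaker wins. In the $(1:b)$ $k$-clique game on $K_n$, Maker does not orient her edges, and she wins if her edges contain a clique on $k$ vertices. The threshold bias of such a game is the largest integer $t\ge 0$ such that for every integer $b$ with $1\le b\le t$ Maker has a winning strategy in the $(1:b)$ game. Then, for every $n$, the threshold bias $b_{\mathcal K_T}(n)$ of the $T$-tournament game on $K_n$ and the threshold bias $b_{\mathcal K_k}(n)$ of the $k$-clique game on $K_n$ exist, and, as $n\to\infty$ with $T$ fixed, $$b_{\mathcal K_T}(n)=\Theta\bigl(n^{2/(k+1)}\bigr).$$ In particular $b_{\mathcal K_T}(n)=\Theta\bigl(b_{\mathcal K_k}(n)\bigr)$. -/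

import Mathlib

open Filter Asymptotics

/-! ### Maker-Breaker games -/

/-- The free (unclaimed) elements of the board `X`. Here `M` is the set of claims made by Maker, a
claim `a : α` occupying the board element `π a`, and `B` is the set of board elements claimed by
Breaker. In an ordinary Maker-Breaker game `π` is the identity; in a game in which Maker also
orients the edges that she claims, `π` forgets the orientation. -/
def freeElements {α β : Type*} [DecidableEq β] (X : Finset β) (π : α → β)
    (M : Finset α) (B : Finset β) : Finset β :=
  X \ (M.image π ∪ B)

/-- `MakerWinsFrom X π goal b M B`: in the `(1:b)` game on the board `X`, Maker, who is about to
move in the position `(M, B)`, has a winning strategy. The game is played until the whole board is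
claimed, and then Maker has won if and only if her set of claims satisfies `goal`. As long as there
is a free element, a round is played: Maker makes one claim on a free element, and then Breaker
claims `b` of the remaining free elements (all of them, if there are fewer than `b`). -/
inductive MakerWinsFrom {α β : Type*} [DecidableEq α] [DecidableEq β] (X : Finset β) (π : α → β)
    (goal : Finset α → Prop) (b : ℕ) : Finset α → Finset β → Prop
  | finished (M : Finset α) (B : Finset β) (hend : freeElements X π M B = ∅) (hgoal : goal M) :
      MakerWinsFrom X π goal b M B
  | round (M : Finset α) (B : Finset β) (a : α) (ha : π a ∈ freeElements X π M B)
      (hreply : ∀ S : Finset β, S ⊆ freeElements X π (insert a M) B →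
        S.card = min b (freeElements X π (insert a M) B).card →
        MakerWinsFrom X π goal b (insert a M) (B ∪ S)) :
      MakerWinsFrom X π goal b M B

/-- The `(1:b)` game on `X`, with Maker moving first, is a Maker's win. -/
def IsMakersWin {α β : Type*} [DecidableEq α] [DecidableEq β] (X : Finset β) (π : α → β)
    (goal : Finset α → Prop) (b : ℕ) : Prop :=
  MakerWinsFrom X π goal b ∅ ∅

/-- `t` is the threshold bias of a game, where `win b` says that its `(1:b)` version is a Maker's
win: `t` is the largest non-negative integer such that for every (positive) bias `b ≤ t` the
`(1:b)` game is a Maker's win. -/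
def IsThresholdBias (win : ℕ → Prop) (t : ℕ) : Prop :=
  IsGreatest {s : ℕ | ∀ b : ℕ, 1 ≤ b → b ≤ s → win b} t

/-! ### The tournament game and the clique game -/

/-- A tournament: a complete graph each of whose edges has exactly one of its two directions. -/
def Digraph.IsTournament {V : Type*} (T : Digraph V) : Prop :=
  (∀ v, ¬ T.Adj v v) ∧ ∀ u v, u ≠ v → Xor (T.Adj u v) (T.Adj v u)

/-- The set `M` of directed edges, `(x, y)` being directed from `x` to `y`, contains a copy of the
directed graph `T`. -/
def ContainsCopy {V W : Type*} (T : Digraph V) (M : Finset (W × W)) : Prop :=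
  ∃ f : V ↪ W, ∀ u v, T.Adj u v → (f u, f v) ∈ M

/-- The `(1:b)` `T`-tournament game on `K_n` is a Maker's win. Maker claims directed edges `(x, y)`,
which occupy the edge `xy` of the board. -/
def TournamentGameMakersWin {V : Type*} (T : Digraph V) (n b : ℕ) : Prop :=
  IsMakersWin (⊤ : SimpleGraph (Fin n)).edgeFinset (fun a : Fin n × Fin n => s(a.1, a.2))
    (ContainsCopy T) b

/-- The `(1:b)` `k`-clique game on `K_n` is a Maker's win. -/
def CliqueGameMakersWin (k n b : ℕ) : Prop :=
  IsMakersWin (⊤ : SimpleGraph (Fin n)).edgeFinset (fun e : Sym2 (Fin n) => e)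
    (fun M => ¬ (SimpleGraph.fromEdgeSet (M : Set (Sym2 (Fin n)))).CliqueFree k) b

/-! ### Maker-Breaker games: general facts and derandomized random play -/

section Games

variable {α β : Type*} [DecidableEq α] [DecidableEq β] {X : Finset β} {π : α → β}
  {goal : Finset α → Prop} {b : ℕ}

/-! Put α = 2/(k+1). Forgetting orientations turns a win in the tournament game into a win in the
clique game (`TournamentGameMakersWin.clique`), so the tournament threshold is at most the clique
threshold. Both orders of magnitude follow once Maker wins the tournament game for all b ≤ c·n^α and
Breaker wins the clique game for some b ≤ C·n^α.

Maker plays at random. Split off k parts of size N = ⌊n/k⌋, one per vertex of T. Each arc of T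
receives m random edges between its two parts, and a sampled edge that is already occupied is
skipped. With density s² = m/N² and N·s^(k+1) a small constant, the expected number of copies of T
among the samples is of order m. The expected number of pairs of distinct copies sharing a sample is
at most half the number of copies, while the expected number of skipped samples is of order
m·s²·(b+1). If b is a small multiple of s⁻², which is of order n^α, some copy avoids all skipped
samples (`exists_good_copy`). Because a lost position always has a Breaker reply that keeps it lost,
conditional expectations replace the probability space (`exists_sample_of_not_makerWinsFrom`).

Breaker, with bias 2q, spends half of each turn closing threats, that is, cliques with all edges but
one claimed by Maker. This works as long as a single Maker move creates at most q threats. The other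
half lowers an Erdős–Selfridge type potential with p = 1/(1+q), taken over r-tuples of marked
cliques through a common edge. More than q threats through one edge would give at least (1+q)^r
completed tuples, hence potential at least (1+q)^r. The initial potential is at most
(n+1)²·((1+q)/2)^r (`sum_tuples_le`), so r of order log q suffices (`BreakerSafe.exists_reply`). -/

lemma freeElements_insert_ssubset {M : Finset α} {B : Finset β} {a : α}
    (ha : π a ∈ freeElements X π M B) (S : Finset β) :
    freeElements X π (insert a M) (B ∪ S) ⊂ freeElements X π M B := by
  refine (Finset.ssubset_iff_of_subset ?_).2 ⟨π a, ha, ?_⟩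
  · intro x
    simp only [freeElements, Finset.mem_sdiff, Finset.mem_union, Finset.mem_image,
      Finset.mem_insert]
    rintro ⟨h1, h2⟩
    refine ⟨h1, fun h => h2 ?_⟩
    rcases h with ⟨y, hy, rfl⟩ | h
    · exact Or.inl ⟨y, Or.inr hy, rfl⟩
    · exact Or.inr (Or.inl h)
  · simp [freeElements]

/-- A position in which Maker already occupies a winning set is won by Maker. -/
lemma MakerWinsFrom.of_goal (hmono : ∀ M M' : Finset α, M ⊆ M' → goal M → goal M')
    (hπ : ∀ x ∈ X, ∃ a, π a = x) {M : Finset α} (B : Finset β) (hM : goal M) :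
    MakerWinsFrom X π goal b M B := by
  induction hc : (freeElements X π M B).card using Nat.strong_induction_on generalizing M B with
  | _ c ih =>
    subst hc
    rcases (freeElements X π M B).eq_empty_or_nonempty with h | ⟨x, hx⟩
    · exact .finished M B h hM
    · obtain ⟨a, rfl⟩ := hπ x (Finset.mem_sdiff.1 hx).1
      refine .round M B a hx fun S _ _ => ?_
      exact ih _ (Finset.card_lt_card (freeElements_insert_ssubset hx S)) _
        (hmono _ _ (Finset.subset_insert _ _) hM) rfl

/-- Forgetting the extra information in Maker's claims turns a win into a win. -/
lemma MakerWinsFrom.image {goal' : Finset β → Prop}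
    (hgoal : ∀ M, goal M → goal' (M.image π)) {M : Finset α} {B : Finset β}
    (h : MakerWinsFrom X π goal b M B) :
    MakerWinsFrom X (fun x : β => x) goal' b (M.image π) B := by
  have hfree : ∀ (M : Finset α) (B : Finset β),
      freeElements X (fun x : β => x) (M.image π) B = freeElements X π M B := by
    intro M B
    simp [freeElements]
  induction h with
  | finished M B hend hM => exact .finished _ _ (by rw [hfree, hend]) (hgoal M hM)
  | round M B a ha _ ih =>
    refine .round _ _ (π a) (by rwa [hfree]) fun S hS hcard => ?_
    rw [← Finset.image_insert] at hS hcard ⊢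
    rw [hfree] at hS hcard
    exact ih S hS hcard

lemma exists_reply_of_not_makerWinsFrom {M : Finset α} {B : Finset β} {a : α}
    (h : ¬ MakerWinsFrom X π goal b M B) (ha : π a ∈ freeElements X π M B) :
    ∃ S : Finset β, S.card ≤ b ∧ ¬ MakerWinsFrom X π goal b (insert a M) (B ∪ S) := by
  by_contra! hcon
  refine h (.round M B a ha fun S _ hS => hcon S ?_)
  omega

/-- Maker plays random moves, the `i`-th one being `cl i` of a uniform sample from `A`, and skips
those that are not available. If a payoff `g` of the samples has mean at least `c`, then some
outcome loses at most `L * ε` of it, even after paying `1` for each skipped move. -/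
lemma exists_sample_of_not_makerWinsFrom {A : Type*} [Fintype A] [Nonempty A] {ε : ℝ} {K : ℕ}
    (hε : (K : ℝ) ≤ ε * Fintype.card A) (L : ℕ) (cl : Fin L → A → α)
    (hinj : ∀ i, Function.Injective fun a => π (cl i a)) (hX : ∀ i a, π (cl i a) ∈ X)
    (g : (Fin L → A) → ℝ) (c : ℝ) (hg : (Fintype.card A : ℝ) ^ L * c ≤ ∑ ω, g ω)
    (M : Finset α) (B : Finset β) (hlose : ¬ MakerWinsFrom X π goal b M B)
    (hK : (M.image π ∪ B).card + L * (b + 1) ≤ K) :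
    ∃ (ω : Fin L → A) (bad : Finset (Fin L)) (M' : Finset α) (B' : Finset β),
      ¬ MakerWinsFrom X π goal b M' B' ∧ M ⊆ M' ∧ (∀ i, i ∉ bad → cl i (ω i) ∈ M') ∧
      c - L * ε ≤ g ω - bad.card := by
  classical
  induction L generalizing c M B with
  | zero =>
    refine ⟨default, ∅, M, B, hlose, subset_rfl, fun i => i.elim0, ?_⟩
    rw [Fintype.sum_unique] at hg
    simpa using hg
  | succ L ih =>
    have hA : (0 : ℝ) < Fintype.card A := by exact_mod_cast Fintype.card_pos
    set taken : A → Prop := fun a => π (cl 0 a) ∈ M.image π ∪ B with htaken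
    have hcount : ((Finset.univ.filter taken).card : ℝ) ≤ ε * Fintype.card A := by
      refine le_trans ?_ hε
      have h1 : (Finset.univ.filter taken).card ≤ (M.image π ∪ B).card :=
        Finset.card_le_card_of_injOn (fun a => π (cl 0 a))
          (fun a ha => by simpa [taken] using ha) (hinj 0).injOn
      have : (Finset.univ.filter taken).card ≤ K := by omega
      exact_mod_cast this
    -- Averaging over the first sample: it is taken with probability at most `ε`, so some value has
    -- conditional mean at least `c - ε`, plus 1 if its move is skipped.
    obtain ⟨a, ha⟩ : ∃ a : A, (Fintype.card A : ℝ) ^ L * (c - ε + if taken a then 1 else 0)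
        ≤ ∑ ω, g (Fin.cons a ω) := by
      by_contra! hcon
      have hlt : ∑ a : A, ∑ ω : Fin L → A, g (Fin.cons a ω) <
          ∑ a : A, (Fintype.card A : ℝ) ^ L * (c - ε + if taken a then 1 else 0) :=
        Finset.sum_lt_sum_of_nonempty Finset.univ_nonempty fun a _ => hcon a
      have hsum : ∑ a : A, ∑ ω : Fin L → A, g (Fin.cons a ω) = ∑ ω, g ω := by
        rw [← (Fin.consEquiv fun _ : Fin (L + 1) => A).sum_comp, Fintype.sum_prod_type]
        rfl
      rw [hsum, ← Finset.mul_sum, Finset.sum_add_distrib, Finset.sum_const, Finset.sum_boole,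
        Finset.card_univ, nsmul_eq_mul] at hlt
      have hpow : (0 : ℝ) < (Fintype.card A : ℝ) ^ L := by positivity
      have : (Fintype.card A : ℝ) * (c - ε) + ((Finset.univ.filter taken).card : ℝ)
          ≤ Fintype.card A * c := by linarith
      have := mul_le_mul_of_nonneg_left this hpow.le
      rw [pow_succ] at hg
      linarith
    obtain ⟨M₁, B₁, hl₁, hM₁, hK₁, hmem⟩ : ∃ (M₁ : Finset α) (B₁ : Finset β),
        ¬ MakerWinsFrom X π goal b M₁ B₁ ∧ M ⊆ M₁ ∧
        (M₁.image π ∪ B₁).card + L * (b + 1) ≤ K ∧ (¬ taken a → cl 0 a ∈ M₁) := by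
      by_cases ht : taken a
      -- A skipped sample uses no round: the position stays as it is.
      · refine ⟨M, B, hlose, subset_rfl, ?_, fun h => (h ht).elim⟩
        refine le_trans ?_ hK
        gcongr
        omega
      · obtain ⟨S, hS, hl⟩ := exists_reply_of_not_makerWinsFrom hlose
          (a := cl 0 a) (Finset.mem_sdiff.2 ⟨hX 0 a, ht⟩)
        refine ⟨_, _, hl, Finset.subset_insert _ _, ?_, fun _ => Finset.mem_insert_self _ _⟩
        have h1 : ((insert (cl 0 a) M).image π ∪ (B ∪ S)).card ≤
            (M.image π ∪ B).card + (b + 1) := by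
          have : (insert (cl 0 a) M).image π ∪ (B ∪ S) =
              (M.image π ∪ B) ∪ insert (π (cl 0 a)) S := by
            ext x
            simp only [Finset.image_insert, Finset.mem_union, Finset.mem_insert]
            tauto
          rw [this]
          refine (Finset.card_union_le _ _).trans ?_
          gcongr
          exact (Finset.card_insert_le _ _).trans (by omega)
        rw [Nat.succ_mul] at hK
        omega
    obtain ⟨ω, bad, M', B', hl, hM', hgood, hval⟩ :=
      ih (fun i => cl i.succ) (fun i => hinj _) (fun i => hX _) (fun ω => g (Fin.cons a ω)) _ ha
        M₁ B₁ hl₁ hK₁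
    refine ⟨Fin.cons a ω, bad.map (Fin.succEmb L) ∪ (if taken a then {0} else ∅), M', B', hl,
      hM₁.trans hM', ?_, ?_⟩
    · intro i
      refine Fin.cases ?_ (fun j => ?_) i
      · intro hi
        simp only [Fin.cons_zero]
        refine hM' (hmem fun ht => hi ?_)
        simp [ht]
      · intro hi
        simp only [Fin.cons_succ]
        refine hgood j fun hj => hi ?_
        simp [hj]
    · have h1 : ((bad.map (Fin.succEmb L) ∪ (if taken a then {0} else ∅)).card : ℝ) ≤
          bad.card + if taken a then 1 else 0 := by
        have := Finset.card_union_le (bad.map (Fin.succEmb L))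
          (if taken a then {0} else ∅)
        rw [Finset.card_map] at this
        split_ifs at this ⊢ with ht
        · exact_mod_cast this
        · simp
      push_cast
      linarith

end Games

/-! ### Breaker's potential and the greedy reply -/

section Potential

variable {β ι : Type*} [DecidableEq β] [Fintype ι]

/-- The potential of a position `(M, B)` with respect to a family of winning sets: each set not yet
hit by `B` contributes `p` to the number of its elements that are missing from `M`. -/
noncomputable def potential (A : ι → Finset β) (p : ℝ) (M B : Finset β) : ℝ :=
  ∑ i, if Disjoint (A i) B then p ^ (A i \ M).card else 0

/-- The loss of potential if Breaker claims `x`. -/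
noncomputable def danger (A : ι → Finset β) (p : ℝ) (M B : Finset β) (x : β) : ℝ :=
  ∑ i, if Disjoint (A i) B ∧ x ∈ A i then p ^ (A i \ M).card else 0

variable {A : ι → Finset β} {p : ℝ}

lemma potential_anti (hp : 0 ≤ p) (M : Finset β) {B B' : Finset β} (h : B ⊆ B') :
    potential A p M B' ≤ potential A p M B := by
  refine Finset.sum_le_sum fun i _ => ?_
  by_cases hd : Disjoint (A i) B'
  · simp [hd, hd.mono_right h]
  · rw [if_neg hd]
    split_ifs <;> positivity

lemma danger_anti (hp : 0 ≤ p) (M : Finset β) {B B' : Finset β} (h : B ⊆ B') (x : β) :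
    danger A p M B' x ≤ danger A p M B x := by
  refine Finset.sum_le_sum fun i _ => ?_
  by_cases hd : Disjoint (A i) B' ∧ x ∈ A i
  · simp [hd, hd.1.mono_right h]
  · rw [if_neg hd]
    split_ifs <;> positivity

lemma potential_insert_right (M B : Finset β) (x : β) :
    potential A p M (insert x B) = potential A p M B - danger A p M B x := by
  rw [potential, potential, danger, ← Finset.sum_sub_distrib]
  refine Finset.sum_congr rfl fun i _ => ?_
  simp only [Finset.disjoint_insert_right]
  by_cases h1 : Disjoint (A i) B <;> by_cases h2 : x ∈ A i <;> simp [h1, h2]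

lemma potential_insert_left {q : ℕ} (hp : p = 1 / (1 + (q : ℝ))) {M : Finset β} (B : Finset β)
    {x : β} (hx : x ∉ M) :
    potential A p (insert x M) B = potential A p M B + q * danger A p M B x := by
  rw [potential, potential, danger, Finset.mul_sum, ← Finset.sum_add_distrib]
  refine Finset.sum_congr rfl fun i _ => ?_
  by_cases h1 : Disjoint (A i) B
  · by_cases h2 : x ∈ A i
    · have h3 : A i \ M = insert x (A i \ insert x M) := by
        ext y
        simp only [Finset.mem_sdiff, Finset.mem_insert]
        by_cases hy : y = x
        · subst hy
          simp [h2, hx]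
        · simp [hy]
      have h4 : (A i \ M).card = (A i \ insert x M).card + 1 := by
        rw [h3, Finset.card_insert_of_notMem (by simp)]
      have hq : (1 + (q : ℝ)) ≠ 0 := by positivity
      simp only [h1, h2, h4, and_self, if_true, pow_succ]
      rw [hp]
      field_simp
    · have h3 : A i \ insert x M = A i \ M := by
        ext y
        simp only [Finset.mem_sdiff, Finset.mem_insert]
        refine and_congr_right fun hy => ?_
        have : y ≠ x := fun h => h2 (h ▸ hy)
        simp [this]
      simp [h2, h3]
  · simp [h1]

/-- Breaker's greedy reply: claiming `q` elements suffices to undo in advance the increase of the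
potential caused by Maker's next move. -/
lemma exists_potential_reply {q : ℕ} (hp : p = 1 / (1 + (q : ℝ))) (F M B : Finset β)
    (hF : Disjoint F M) :
    ∃ S ⊆ F, S.card ≤ q ∧ ∀ x ∈ F \ S,
      potential A p (insert x M) (B ∪ S) ≤ potential A p M B := by
  have hp0 : 0 ≤ p := by rw [hp]; positivity
  have key : ∀ i : ℕ, ∃ S ⊆ F, S.card ≤ i ∧ ∀ x ∈ F \ S,
      potential A p M (B ∪ S) + i * danger A p M (B ∪ S) x ≤ potential A p M B := by
    intro i
    induction i with
    | zero => exact ⟨∅, by simp, by simp, by simp⟩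
    | succ i ih =>
      obtain ⟨S, hSF, hS, h⟩ := ih
      rcases (F \ S).eq_empty_or_nonempty with he | hne
      · exact ⟨S, hSF, hS.trans (Nat.le_succ i), by simp [he]⟩
      -- Claiming `y` of maximal danger lowers the potential by that danger, which pays for raising
      -- the coefficient from `i` to `i + 1`.
      · obtain ⟨y, hy, hmax⟩ := Finset.exists_max_image _ (danger A p M (B ∪ S)) hne
        refine ⟨insert y S, Finset.insert_subset (Finset.mem_sdiff.1 hy).1 hSF,
          (Finset.card_insert_le _ _).trans (by omega), fun x hx => ?_⟩
        have hx' : x ∈ F \ S := by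
          simp only [Finset.mem_sdiff, Finset.mem_insert, not_or] at hx ⊢
          exact ⟨hx.1, hx.2.2⟩
        have h1 := h y hy
        have h2 := hmax x hx'
        have h3 : danger A p M (B ∪ insert y S) x ≤ danger A p M (B ∪ S) x :=
          danger_anti hp0 M (Finset.union_subset_union_right (Finset.subset_insert _ _)) x
        have h4 : potential A p M (B ∪ insert y S) =
            potential A p M (B ∪ S) - danger A p M (B ∪ S) y := by
          rw [Finset.union_insert, potential_insert_right]
        rw [h4]
        push_cast
        have h5 : ((i : ℝ) + 1) * danger A p M (B ∪ insert y S) x ≤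
            ((i : ℝ) + 1) * danger A p M (B ∪ S) y := by
          gcongr
          exact h3.trans h2
        linarith
  obtain ⟨S, hSF, hS, h⟩ := key q
  refine ⟨S, hSF, hS, fun x hx => ?_⟩
  rw [potential_insert_left hp _ (Finset.disjoint_left.1 hF (Finset.mem_sdiff.1 hx).1)]
  exact h x hx

end Potential

/-! ### Edges inside a vertex set -/

section Pairs

variable {W : Type*} [DecidableEq W]

/-- The edges of the complete graph on `U`. -/
def edgesWithin (U : Finset W) : Finset (Sym2 W) :=
  U.sym2.filter fun e => ¬ e.IsDiag

lemma mem_edgesWithin {U : Finset W} {e : Sym2 W} :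
    e ∈ edgesWithin U ↔ (∀ v ∈ e, v ∈ U) ∧ ¬ e.IsDiag := by
  simp [edgesWithin, Finset.mem_sym2_iff]

lemma mk_mem_edgesWithin {U : Finset W} {x y : W} :
    s(x, y) ∈ edgesWithin U ↔ x ∈ U ∧ y ∈ U ∧ x ≠ y := by
  simp [edgesWithin, and_assoc]

lemma card_edgesWithin (U : Finset W) : (edgesWithin U).card = U.card.choose 2 := by
  rw [← Sym2.card_image_offDiag]
  congr 1
  ext e
  induction e with
  | _ x y =>
    rw [mk_mem_edgesWithin]
    simp only [Finset.mem_image, Finset.mem_offDiag, Prod.exists]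
    constructor
    · rintro ⟨hx, hy, h⟩
      exact ⟨x, y, ⟨hx, hy, h⟩, rfl⟩
    · rintro ⟨a, b, ⟨ha, hb, h⟩, he⟩
      rcases Sym2.eq_iff.1 he with ⟨rfl, rfl⟩ | ⟨rfl, rfl⟩
      · exact ⟨ha, hb, h⟩
      · exact ⟨hb, ha, h.symm⟩

lemma edgesWithin_mono {U U' : Finset W} (h : U ⊆ U') : edgesWithin U ⊆ edgesWithin U' := by
  intro e
  simp only [mem_edgesWithin]
  exact fun he => ⟨fun v hv => h (he.1 v hv), he.2⟩

lemma edgesWithin_inter (U U' : Finset W) :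
    edgesWithin (U ∩ U') = edgesWithin U ∩ edgesWithin U' := by
  ext e
  simp only [mem_edgesWithin, Finset.mem_inter]
  constructor
  · exact fun h => ⟨⟨fun v hv => (h.1 v hv).1, h.2⟩, fun v hv => (h.1 v hv).2, h.2⟩
  · exact fun h => ⟨fun v hv => ⟨h.1.1 v hv, h.2.1 v hv⟩, h.1.2⟩

lemma card_edgesWithin_sdiff (U Z : Finset W) :
    (edgesWithin U \ edgesWithin Z).card = U.card.choose 2 - (U ∩ Z).card.choose 2 := by
  rw [← Finset.sdiff_inter_self_left, ← edgesWithin_inter, Finset.card_sdiff_of_subset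
    (edgesWithin_mono Finset.inter_subset_left), card_edgesWithin, card_edgesWithin]

end Pairs

/-! ### Weight of the tuples of marked cliques -/

section Threats

variable {n : ℕ}

/-- The `k`-cliques through the edge `e`, together with a marked edge. -/
def markedCliques (n k : ℕ) (e : Sym2 (Fin n)) : Finset (Finset (Fin n) × Sym2 (Fin n)) :=
  Finset.univ.filter fun τ => τ.1.card = k ∧ e ∈ edgesWithin τ.1 ∧ τ.2 ∈ edgesWithin τ.1

/-- The unmarked edges of a clique with a marked edge. -/
def unmarkedEdges (τ : Finset (Fin n) × Sym2 (Fin n)) : Finset (Sym2 (Fin n)) :=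
  edgesWithin τ.1 \ {τ.2}

/-- The edges covered by a tuple of marked cliques. -/
def tupleEdges {k r : ℕ} {e : Sym2 (Fin n)} (τ : Fin r → markedCliques n k e) :
    Finset (Sym2 (Fin n)) :=
  Finset.univ.biUnion fun i => unmarkedEdges (τ i).1

/-- Such a clique is determined by its other `j - 2` vertices in `Z` and its `k - j` vertices
outside `Z`. -/
lemma card_cliques_inter_le {x y : Fin n} (hxy : x ≠ y) {Z : Finset (Fin n)} (hx : x ∈ Z)
    (hy : y ∈ Z) (k j : ℕ) :
    (Finset.univ.filter fun U : Finset (Fin n) =>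
      (U.card = k ∧ x ∈ U ∧ y ∈ U) ∧ (U ∩ Z).card = j).card ≤ Z.card ^ (j - 2) * n ^ (k - j) := by
  have h1 : (Finset.univ.filter fun U : Finset (Fin n) =>
      (U.card = k ∧ x ∈ U ∧ y ∈ U) ∧ (U ∩ Z).card = j).card ≤
      (Finset.powersetCard (j - 2) Z ×ˢ
        Finset.powersetCard (k - j) (Finset.univ : Finset (Fin n))).card := by
    refine Finset.card_le_card_of_injOn (fun U => ((U ∩ Z) \ {x, y}, U \ Z)) ?_ ?_
    · intro U hU
      simp only [Finset.coe_filter, Finset.mem_univ, true_and, Set.mem_ofPred_eq] at hU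
      obtain ⟨⟨hk, hxU, hyU⟩, hj⟩ := hU
      simp only [Finset.coe_product, Set.mem_prod, Finset.mem_coe, Finset.mem_powersetCard]
      refine ⟨⟨fun v hv => ?_, ?_⟩, Finset.subset_univ _, ?_⟩
      · exact (Finset.mem_inter.1 (Finset.mem_sdiff.1 hv).1).2
      · rw [Finset.card_sdiff_of_subset, hj, Finset.card_pair hxy]
        intro v hv
        rcases Finset.mem_insert.1 hv with rfl | hv
        · exact Finset.mem_inter.2 ⟨hxU, hx⟩
        · rw [Finset.mem_singleton] at hv
          subst hv
          exact Finset.mem_inter.2 ⟨hyU, hy⟩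
      · have := Finset.card_sdiff_add_card_inter U Z
        omega
    · intro U hU U' hU' h
      simp only [Finset.coe_filter, Finset.mem_univ, true_and, Set.mem_ofPred_eq] at hU hU'
      simp only [Prod.mk.injEq] at h
      ext v
      by_cases hv : v ∈ Z
      · by_cases hvx : v = x
        · subst hvx
          simp [hU.1.2.1, hU'.1.2.1]
        · by_cases hvy : v = y
          · subst hvy
            simp [hU.1.2.2, hU'.1.2.2]
          · have := Finset.ext_iff.1 h.1 v
            simpa [hv, hvx, hvy] using this
      · have := Finset.ext_iff.1 h.2 v
        simpa [hv] using this
  refine h1.trans ?_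
  rw [Finset.card_product, Finset.card_powersetCard, Finset.card_powersetCard, Finset.card_univ,
    Fintype.card_fin]
  exact Nat.mul_le_mul (Nat.choose_le_pow _ _) (Nat.choose_le_pow _ _)

lemma two_mul_choose_two (j : ℕ) : 2 * j.choose 2 = j * (j - 1) := by
  rw [Nat.choose_two_right, Nat.mul_div_cancel' (Nat.even_mul_pred_self j).two_dvd]

/-- Since `k + j - 1 ≥ k + 1` for `j ≥ 2`, each vertex outside a `j`-subset contributes a factor of
at most `s ^ (k + 1)` to the weight. Both players' estimates rest on this. -/
lemma two_mul_choose_two_sub {j k : ℕ} (hj : 1 ≤ j) (hjk : j ≤ k) :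
    2 * (k.choose 2 - j.choose 2) = (k + j - 1) * (k - j) := by
  rw [Nat.mul_sub, two_mul_choose_two, two_mul_choose_two]
  obtain ⟨d, rfl⟩ := Nat.exists_eq_add_of_le hjk
  obtain ⟨i, rfl⟩ := Nat.exists_eq_add_of_le' hj
  have h1 : i + 1 + d - 1 = i + d := by omega
  have h2 : i + 1 + d + (i + 1) - 1 = 2 * i + d + 1 := by omega
  have h3 : i + 1 + d - (i + 1) = d := by omega
  rw [h1, h2, h3, Nat.add_sub_cancel]
  apply Nat.sub_eq_of_eq_add
  ring

/-- The weight of the cliques that meet a given small vertex set in `j` vertices. -/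
lemma clique_weight_le {s c : ℝ} {k j n z : ℕ} (hs : 0 < s) (hs1 : s ≤ 1) (hc1 : c ≤ 1)
    (hn : n * s ^ (k + 1) ≤ c) (hz : 1 ≤ z) (hk : 3 ≤ k) (hj : 2 ≤ j) (hjk : j ≤ k) :
    s ^ 2 * ((z : ℝ) ^ (j - 2) * (n : ℝ) ^ (k - j) *
      (s ^ 2) ^ (k.choose 2 - j.choose 2 - 1)) ≤ (if j = 2 then c else 0) + z ^ k * s := by
  have hz1 : (1 : ℝ) ≤ z := by exact_mod_cast hz
  have hc0 : 0 ≤ c := le_trans (by positivity) hn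
  rcases hjk.lt_or_eq with hlt | rfl
  · have hexp : 1 ≤ k.choose 2 - j.choose 2 := by
      have := two_mul_choose_two_sub (by omega) hlt.le
      have h2 : 1 ≤ (k + j - 1) * (k - j) := Nat.mul_pos (by omega) (by omega)
      omega
    have h1 : s ^ 2 * (s ^ 2) ^ (k.choose 2 - j.choose 2 - 1) = (s ^ (k + j - 1)) ^ (k - j) := by
      rw [← pow_succ', Nat.sub_add_cancel hexp, ← pow_mul, ← pow_mul,
        two_mul_choose_two_sub (by omega) hlt.le]
    have h2 : s ^ 2 * ((z : ℝ) ^ (j - 2) * (n : ℝ) ^ (k - j) *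
        (s ^ 2) ^ (k.choose 2 - j.choose 2 - 1)) =
        (z : ℝ) ^ (j - 2) * (n * s ^ (k + j - 1)) ^ (k - j) := by
      rw [mul_pow, ← h1]
      ring
    -- Only `j = 2` gives the constant `c`; each further shared vertex gains a factor `s`, which
    -- beats the power of `z`.
    have h3 : n * s ^ (k + j - 1) ≤ c * s ^ (j - 2) := by
      have : k + j - 1 = (k + 1) + (j - 2) := by omega
      rw [this, pow_add, ← mul_assoc]
      gcongr
    have h4 : s ^ (j - 2) ≤ 1 := pow_le_one₀ hs.le hs1
    have h5 : (n * s ^ (k + j - 1)) ^ (k - j) ≤ c * s ^ (j - 2) := by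
      calc (n * s ^ (k + j - 1)) ^ (k - j) ≤ n * s ^ (k + j - 1) := by
            apply pow_le_of_le_one (by positivity) _ (by omega)
            exact h3.trans (mul_le_one₀ hc1 (by positivity) h4)
        _ ≤ _ := h3
    rw [h2]
    split_ifs with hj2
    · subst hj2
      simp only [Nat.sub_self, pow_zero, one_mul, mul_one] at h5 ⊢
      have : 0 ≤ (z : ℝ) ^ k * s := by positivity
      linarith
    · rw [zero_add]
      refine mul_le_mul (pow_le_pow_right₀ hz1 (by omega)) (h5.trans ?_) (by positivity)
        (by positivity)
      calc c * s ^ (j - 2) ≤ 1 * s ^ (j - 2) := by gcongr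
        _ ≤ s := by
          rw [one_mul]
          exact pow_le_of_le_one hs.le hs1 (by omega)
  · rw [if_neg (by omega), zero_add]
    simp only [Nat.sub_self, Nat.zero_sub, pow_zero, mul_one]
    rw [mul_comm]
    gcongr
    · omega
    · exact pow_le_of_le_one hs.le hs1 (by omega)

/-- The inductive step for tuples: once the edges `F` are paid for, one more marked clique
contributes a factor of at most `(1 + q) / 2` when `s ^ 2 = 1 / (1 + q)`. The gain over `1 + q` is
the factor 1/2. Cliques are sorted by the size of their intersection with `Z`, and the choice of the
mark costs at most `k ^ 2`. -/
lemma sum_markedCliques_le {s c : ℝ} {k z : ℕ} (hs : 0 < s) (hs1 : s ≤ 1) (hc1 : c ≤ 1)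
    (hn : n * s ^ (k + 1) ≤ c) (hz : 1 ≤ z) (hk : 3 ≤ k)
    (hsmall : (k : ℝ) ^ 2 * (c + k * ((z : ℝ) ^ k * s)) ≤ 1 / 2)
    (e : Sym2 (Fin n)) (Z : Finset (Fin n)) (heZ : ∀ v ∈ e, v ∈ Z) (hZ : Z.card ≤ z)
    (F : Finset (Sym2 (Fin n))) (hF : F ⊆ edgesWithin Z) :
    ∑ τ ∈ markedCliques n k e, (s ^ 2) ^ (unmarkedEdges τ \ F).card ≤ 1 / 2 / s ^ 2 := by
  have hc0 : 0 ≤ c := le_trans (by positivity) hn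
  induction e with
  | _ x y =>
  have hx : x ∈ Z := heZ x (by simp)
  have hy : y ∈ Z := heZ y (by simp)
  by_cases hxy : x = y
  · have : markedCliques n k s(x, y) = ∅ := by
      simp [markedCliques, mk_mem_edgesWithin, hxy]
    rw [this, Finset.sum_empty]
    positivity
  set 𝒰 : Finset (Finset (Fin n)) := Finset.univ.filter fun U => U.card = k ∧ x ∈ U ∧ y ∈ U
    with h𝒰
  set w : ℕ → ℝ := fun j => (s ^ 2) ^ (k.choose 2 - j.choose 2 - 1) with hw
  have hw0 : ∀ j, 0 ≤ w j := fun j => by positivity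
  have hp1 : s ^ 2 ≤ 1 := pow_le_one₀ hs.le hs1
  have step1 : ∑ τ ∈ markedCliques n k s(x, y), (s ^ 2) ^ (unmarkedEdges τ \ F).card ≤
      ∑ U ∈ 𝒰, (k : ℝ) ^ 2 * w (U ∩ Z).card := by
    have hsig : ∑ τ ∈ markedCliques n k s(x, y), (s ^ 2) ^ (unmarkedEdges τ \ F).card =
        ∑ U ∈ 𝒰, ∑ f ∈ edgesWithin U, (s ^ 2) ^ (unmarkedEdges (U, f) \ F).card := by
      refine Finset.sum_finset_product _ _ _ ?_
      rintro ⟨U, f⟩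
      simp [markedCliques, h𝒰, mk_mem_edgesWithin, hxy, and_assoc]
    rw [hsig]
    refine Finset.sum_le_sum fun U hU => ?_
    have hUk : U.card = k := (Finset.mem_filter.1 hU).2.1
    calc ∑ f ∈ edgesWithin U, (s ^ 2) ^ (unmarkedEdges (U, f) \ F).card
        ≤ ∑ f ∈ edgesWithin U, w (U ∩ Z).card := by
          refine Finset.sum_le_sum fun f _ => ?_
          refine pow_le_pow_of_le_one (by positivity) hp1 ?_
          rw [← hUk, ← card_edgesWithin_sdiff, tsub_le_iff_right]
          -- Besides the edges within `Z`, only the marked edge may fail to be charged; hence the `-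
          -- 1` in `w`.
          have : edgesWithin U \ edgesWithin Z ⊆ insert f (unmarkedEdges (U, f) \ F) := by
            intro g hg
            rw [Finset.mem_sdiff] at hg
            by_cases hgf : g = f
            · simp [hgf]
            · refine Finset.mem_insert_of_mem (Finset.mem_sdiff.2 ⟨?_, fun h => hg.2 (hF h)⟩)
              simp [unmarkedEdges, hg.1, hgf]
          exact (Finset.card_le_card this).trans (Finset.card_insert_le _ _)
      _ = ((edgesWithin U).card : ℝ) * w (U ∩ Z).card := by
          rw [Finset.sum_const, nsmul_eq_mul]
      _ ≤ _ := by
          have := hw0 (U ∩ Z).card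
          gcongr
          rw [card_edgesWithin, hUk]
          exact_mod_cast Nat.choose_le_pow k 2
  have step2 : ∑ U ∈ 𝒰, w (U ∩ Z).card ≤
      ∑ j ∈ Finset.Icc 2 k, (z : ℝ) ^ (j - 2) * (n : ℝ) ^ (k - j) * w j := by
    have hmaps : ∀ U ∈ 𝒰, (U ∩ Z).card ∈ Finset.Icc 2 k := by
      intro U hU
      obtain ⟨hUk, hxU, hyU⟩ := (Finset.mem_filter.1 hU).2
      rw [Finset.mem_Icc]
      constructor
      · rw [← Finset.card_pair hxy]
        refine Finset.card_le_card fun v hv => ?_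
        rcases Finset.mem_insert.1 hv with rfl | hv
        · exact Finset.mem_inter.2 ⟨hxU, hx⟩
        · rw [Finset.mem_singleton] at hv
          subst hv
          exact Finset.mem_inter.2 ⟨hyU, hy⟩
      · rw [← hUk]
        exact Finset.card_le_card Finset.inter_subset_left
    rw [← Finset.sum_fiberwise_of_maps_to hmaps]
    refine Finset.sum_le_sum fun j _ => ?_
    have : ∑ U ∈ 𝒰 with (U ∩ Z).card = j, w (U ∩ Z).card =
        ((𝒰.filter fun U => (U ∩ Z).card = j).card : ℝ) * w j := by
      rw [← nsmul_eq_mul, ← Finset.sum_const]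
      exact Finset.sum_congr rfl fun U hU => by rw [(Finset.mem_filter.1 hU).2]
    rw [this, h𝒰, Finset.filter_filter]
    have h1 : (Finset.univ.filter fun U : Finset (Fin n) =>
        (U.card = k ∧ x ∈ U ∧ y ∈ U) ∧ (U ∩ Z).card = j).card ≤ z ^ (j - 2) * n ^ (k - j) :=
      (card_cliques_inter_le hxy hx hy k j).trans (by gcongr)
    refine mul_le_mul_of_nonneg_right ?_ (hw0 j)
    exact_mod_cast h1
  have step3 : s ^ 2 * ∑ j ∈ Finset.Icc 2 k, (z : ℝ) ^ (j - 2) * (n : ℝ) ^ (k - j) * w j ≤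
      c + k * ((z : ℝ) ^ k * s) := by
    rw [Finset.mul_sum]
    calc _ ≤ ∑ j ∈ Finset.Icc 2 k, ((if j = 2 then c else 0) + z ^ k * s) := by
          refine Finset.sum_le_sum fun j hj => ?_
          rw [Finset.mem_Icc] at hj
          exact clique_weight_le hs hs1 hc1 hn hz hk hj.1 hj.2
      _ = c + ((k - 1 : ℕ) : ℝ) * (z ^ k * s) := by
          rw [Finset.sum_add_distrib, Finset.sum_ite_eq' , Finset.sum_const, Nat.card_Icc,
            if_pos (Finset.mem_Icc.2 ⟨le_rfl, by omega⟩), nsmul_eq_mul]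
          congr 3
      _ ≤ _ := by
          gcongr
          omega
  rw [le_div_iff₀ (by positivity)]
  calc _ ≤ (∑ U ∈ 𝒰, (k : ℝ) ^ 2 * w (U ∩ Z).card) * s ^ 2 := by gcongr
    _ = (k : ℝ) ^ 2 * (s ^ 2 * ∑ U ∈ 𝒰, w (U ∩ Z).card) := by
        rw [← Finset.mul_sum]
        ring
    _ ≤ (k : ℝ) ^ 2 * (c + k * ((z : ℝ) ^ k * s)) := by
        gcongr
        exact le_trans (by gcongr) step3
    _ ≤ 1 / 2 := hsmall

lemma exists_vertices_tupleEdges {k r : ℕ} {x y : Fin n} (τ : Fin r → markedCliques n k s(x, y)) :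
    ∃ Z : Finset (Fin n), x ∈ Z ∧ y ∈ Z ∧ Z.card ≤ 2 + k * r ∧
      tupleEdges τ ⊆ edgesWithin Z := by
  refine ⟨{x, y} ∪ Finset.univ.biUnion fun i => (τ i).1.1, by simp, by simp, ?_, ?_⟩
  · refine (Finset.card_union_le _ _).trans (add_le_add Finset.card_le_two ?_)
    rw [mul_comm]
    refine (Finset.card_biUnion_le_card_mul _ _ k fun i _ => ?_).trans (by simp)
    exact (Finset.mem_filter.1 (τ i).2).2.1.le
  · refine Finset.biUnion_subset.2 fun i _ => Finset.sdiff_subset.trans (edgesWithin_mono ?_)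
    exact (Finset.subset_biUnion_of_mem (fun i => (τ i).1.1) (Finset.mem_univ i)).trans
      Finset.subset_union_right

/-- Tuples are built one clique at a time, and a new clique is charged only for edges not yet
covered. The cliques already chosen span at most `z` vertices together with `e`. -/
lemma sum_tuples_le {s c : ℝ} {k z : ℕ} (hs : 0 < s) (hs1 : s ≤ 1) (hc1 : c ≤ 1)
    (hn : n * s ^ (k + 1) ≤ c) (hk : 3 ≤ k)
    (hsmall : (k : ℝ) ^ 2 * (c + k * ((z : ℝ) ^ k * s)) ≤ 1 / 2)
    (e : Sym2 (Fin n)) (r : ℕ) (hz : 2 + k * r ≤ z) :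
    ∑ τ : Fin r → markedCliques n k e, (s ^ 2) ^ (tupleEdges τ).card ≤ (1 / 2 / s ^ 2) ^ r := by
  induction r with
  | zero => simp [tupleEdges]
  | succ r ih =>
    rw [← (Fin.consEquiv fun _ : Fin (r + 1) => markedCliques n k e).sum_comp,
      Fintype.sum_prod_type_right, pow_succ]
    have hz' : 2 + k * r ≤ z := le_trans (by gcongr; omega) hz
    calc _ = ∑ τ : Fin r → markedCliques n k e, (s ^ 2) ^ (tupleEdges τ).card *
          ∑ σ : markedCliques n k e, (s ^ 2) ^ (unmarkedEdges σ.1 \ tupleEdges τ).card := by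
          refine Finset.sum_congr rfl fun τ _ => ?_
          rw [Finset.mul_sum]
          refine Finset.sum_congr rfl fun σ _ => ?_
          rw [← pow_add]
          congr 1
          have : tupleEdges ((Fin.consEquiv fun _ : Fin (r + 1) => markedCliques n k e) (σ, τ)) =
              tupleEdges τ ∪ unmarkedEdges σ.1 := by
            ext f
            simp [tupleEdges, Fin.exists_fin_succ, or_comm]
          rw [this, ← Finset.union_sdiff_self_eq_union,
            Finset.card_union_of_disjoint Finset.disjoint_sdiff]
      _ ≤ ∑ τ : Fin r → markedCliques n k e, (s ^ 2) ^ (tupleEdges τ).card * (1 / 2 / s ^ 2) := by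
          gcongr with τ
          induction e with
          | _ x y =>
            obtain ⟨Z, hx, hy, hZ, hF⟩ := exists_vertices_tupleEdges τ
            rw [Finset.sum_coe_sort (markedCliques n k s(x, y))
              fun σ => (s ^ 2) ^ (unmarkedEdges σ \ tupleEdges τ).card]
            refine sum_markedCliques_le hs hs1 hc1 hn (by omega) hk hsmall _ Z ?_
              (hZ.trans hz') _ hF
            intro v hv
            rcases Sym2.mem_iff.1 hv with rfl | rfl
            · exact hx
            · exact hy
      _ = (∑ τ : Fin r → markedCliques n k e, (s ^ 2) ^ (tupleEdges τ).card) *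
            (1 / 2 / s ^ 2) := by rw [Finset.sum_mul]
      _ ≤ _ := by
          exact mul_le_mul_of_nonneg_right (ih hz') (by positivity)

end Threats

/-! ### Breaker's strategy in the clique game -/

section Breaker

lemma danger_le_potential {β ι : Type*} [DecidableEq β] [Fintype ι] {A : ι → Finset β} {p : ℝ}
    (hp : 0 ≤ p) (M B : Finset β) (x : β) : danger A p M B x ≤ potential A p M B := by
  refine Finset.sum_le_sum fun i _ => ?_
  by_cases h1 : Disjoint (A i) B <;> by_cases h2 : x ∈ A i <;> simp [h1, h2]
  positivity

variable {n : ℕ}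

/-- The tuples of `r` marked cliques through a common edge. -/
abbrev ThreatTuple (n k r : ℕ) : Type :=
  Σ e : Sym2 (Fin n), Fin r → markedCliques n k e

/-- The set of edges of a tuple of marked cliques, none of which is marked in its clique. -/
def threatEdges {k r : ℕ} (τ : ThreatTuple n k r) : Finset (Sym2 (Fin n)) :=
  tupleEdges τ.2

/-- The invariant that Breaker maintains whenever Maker is about to move. -/
structure BreakerSafe (n k r : ℕ) (p Ψ : ℝ) (M B : Finset (Sym2 (Fin n))) : Prop where
  potential_le : ∀ x ∈ freeElements (⊤ : SimpleGraph (Fin n)).edgeFinset (fun e => e) M B,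
    potential (threatEdges (n := n) (k := k) (r := r)) p (insert x M) B ≤ Ψ
  blocked : ∀ (U : Finset (Fin n)) (f : Sym2 (Fin n)), U.card = k → f ∈ edgesWithin U →
    unmarkedEdges (U, f) ⊆ M → f ∈ B
  disjoint : Disjoint M B

/-- Repetitions are allowed in a tuple, so `t` completed marked cliques through `e` give `t ^ r`
tuples of weight 1. -/
lemma card_pow_le_potential {k r : ℕ} {p : ℝ} (hp : 0 ≤ p) {M B : Finset (Sym2 (Fin n))}
    (hMB : Disjoint M B) (e : Sym2 (Fin n)) :
    (((markedCliques n k e).filter fun τ => unmarkedEdges τ ⊆ M).card : ℝ) ^ r ≤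
      potential (threatEdges (n := n) (k := k) (r := r)) p M B := by
  classical
  set Y := (markedCliques n k e).filter fun τ => unmarkedEdges τ ⊆ M with hY
  have hsub : ∀ σ : Y, σ.1 ∈ markedCliques n k e := fun σ => (Finset.mem_filter.1 σ.2).1
  set ψ : (Fin r → Y) → ThreatTuple n k r := fun τ => ⟨e, fun i => ⟨(τ i).1, hsub (τ i)⟩⟩ with hψ
  have hinj : Function.Injective ψ := by
    intro τ τ' h
    have h' := eq_of_heq (Sigma.mk.inj h).2
    funext i
    have := congrFun h' i
    exact Subtype.ext (Subtype.mk.inj this)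
  have hval : ∀ τ : Fin r → Y, threatEdges (ψ τ) ⊆ M := by
    intro τ
    exact Finset.biUnion_subset.2 fun i _ => (Finset.mem_filter.1 (τ i).2).2
  calc ((Y.card : ℕ) : ℝ) ^ r = ∑ _τ : Fin r → Y, (1 : ℝ) := by simp
    _ = ∑ τ : Fin r → Y, (if Disjoint (threatEdges (ψ τ)) B
          then p ^ (threatEdges (ψ τ) \ M).card else 0) := by
        refine Finset.sum_congr rfl fun τ _ => ?_
        rw [if_pos (hMB.mono_left (hval τ)), Finset.sdiff_eq_empty_iff_subset.2 (hval τ)]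
        simp
    _ = ∑ σ ∈ Finset.univ.image ψ, (if Disjoint (threatEdges σ) B
          then p ^ (threatEdges σ \ M).card else 0) := by
        rw [Finset.sum_image hinj.injOn]
    _ ≤ _ := by
        refine Finset.sum_le_univ_sum_of_nonneg fun σ => ?_
        split_ifs <;> positivity

variable {k r q : ℕ} {p Ψ : ℝ}

lemma breakerSafe_empty (hk : 3 ≤ k) (hp : p = 1 / (1 + (q : ℝ)))
    (hΨ : (1 + q) * potential (threatEdges (n := n) (k := k) (r := r)) p ∅ ∅ ≤ Ψ) :
    BreakerSafe n k r p Ψ ∅ ∅ := by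
  have hp0 : 0 ≤ p := by rw [hp]; positivity
  refine ⟨fun x _ => ?_, fun U f hU hf hsub => ?_, by simp⟩
  -- Maker's opening move multiplies the potential by at most `1 + q`, because the danger is at most
  -- the potential.
  · rw [potential_insert_left hp ∅ (Finset.notMem_empty x)]
    refine le_trans ?_ hΨ
    rw [add_mul, one_mul]
    gcongr
    exact danger_le_potential hp0 _ _ _
  · exfalso
    have h1 : (unmarkedEdges (U, f)).card = 0 := by
      rw [Finset.subset_empty.1 hsub, Finset.card_empty]
    have h2 : (edgesWithin U).card - 1 ≤ (unmarkedEdges (U, f)).card :=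
      Finset.le_card_sdiff {f} (edgesWithin U)
    rw [card_edgesWithin, hU] at h2
    have h3 := Nat.choose_le_choose 2 hk
    have h4 : Nat.choose 3 2 = 3 := by decide
    omega

/-- `S₁` controls the potential against the next Maker move, and `S₂` closes the threats through
`a`. Each has at most `q` elements; the rest of the turn is arbitrary, since extra Breaker edges do
no harm. -/
lemma BreakerSafe.exists_reply (hp : p = 1 / (1 + (q : ℝ))) (hΨ : Ψ < (1 + (q : ℝ)) ^ r)
    {M B : Finset (Sym2 (Fin n))} (h : BreakerSafe n k r p Ψ M B) {a : Sym2 (Fin n)}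
    (ha : a ∈ freeElements (⊤ : SimpleGraph (Fin n)).edgeFinset (fun e => e) M B) :
    ∃ S ⊆ freeElements (⊤ : SimpleGraph (Fin n)).edgeFinset (fun e => e) (insert a M) B,
      S.card = min (2 * q) (freeElements (⊤ : SimpleGraph (Fin n)).edgeFinset (fun e => e)
        (insert a M) B).card ∧ BreakerSafe n k r p Ψ (insert a M) (B ∪ S) := by
  have hp0 : 0 ≤ p := by rw [hp]; positivity
  set X := (⊤ : SimpleGraph (Fin n)).edgeFinset with hX
  have hfree : ∀ (M B : Finset (Sym2 (Fin n))) (x), x ∈ freeElements X (fun e => e) M B ↔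
      x ∈ X ∧ x ∉ M ∧ x ∉ B := by
    intro M B x
    simp [freeElements]
  set F := freeElements X (fun e => e) (insert a M) B with hF
  obtain ⟨haX, haM, haB⟩ := (hfree M B a).1 ha
  have hdisj : Disjoint (insert a M) B := Finset.disjoint_insert_left.2 ⟨haB, h.disjoint⟩
  have hFM : Disjoint F (insert a M) :=
    Finset.disjoint_left.2 fun x hx => ((hfree _ _ x).1 hx).2.1
  obtain ⟨S₁, hS₁F, hS₁, hpot⟩ := exists_potential_reply
    (A := threatEdges (n := n) (k := k) (r := r)) hp F (insert a M) B hFM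
  set Y := (markedCliques n k a).filter fun τ => unmarkedEdges τ ⊆ insert a M with hY
  set S₂ := (Y.image Prod.snd) ∩ F with hS₂
  have hYq : Y.card ≤ q := by
    by_contra hcon
    have h1 : (1 + (q : ℝ)) ^ r ≤ (Y.card : ℝ) ^ r := by
      gcongr
      have : 1 + q ≤ Y.card := by omega
      exact_mod_cast this
    have h2 := card_pow_le_potential (k := k) (r := r) hp0 hdisj a
    have h3 := h.potential_le a ha
    linarith
  have hcard : (S₁ ∪ S₂).card ≤ min (2 * q) F.card := by
    refine le_min ?_ (Finset.card_le_card (Finset.union_subset hS₁F Finset.inter_subset_right))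
    have h1 : S₂.card ≤ Y.card :=
      (Finset.card_le_card Finset.inter_subset_left).trans Finset.card_image_le
    have := Finset.card_union_le S₁ S₂
    omega
  obtain ⟨S, hsub, hSF, hScard⟩ := Finset.exists_subsuperset_card_eq
    (Finset.union_subset hS₁F Finset.inter_subset_right) hcard (min_le_right _ _)
  refine ⟨S, hSF, hScard, ?_, ?_, ?_⟩
  · intro x hx
    obtain ⟨hxX, hxM, hxB⟩ := (hfree _ _ x).1 hx
    rw [Finset.mem_union, not_or] at hxB
    have hxF : x ∈ F := (hfree _ _ x).2 ⟨hxX, hxM, hxB.1⟩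
    have hx1 : x ∉ S₁ := fun hh => hxB.2 (hsub (Finset.mem_union_left _ hh))
    calc _ ≤ potential (threatEdges (n := n) (k := k) (r := r)) p (insert x (insert a M))
          (B ∪ S₁) := potential_anti hp0 _ (Finset.union_subset_union_right
            (Finset.subset_union_left.trans hsub))
      _ ≤ _ := hpot x (Finset.mem_sdiff.2 ⟨hxF, hx1⟩)
      _ ≤ Ψ := h.potential_le a ha
  · intro U f hU hf hsubM
    by_cases haU : a ∈ unmarkedEdges (U, f)
    · have haU' : a ∈ edgesWithin U := (Finset.mem_sdiff.1 haU).1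
      by_cases hfM : f ∈ insert a M
      -- All of `U` would now be Maker's, so `a` was its only missing edge before the move, and the
      -- invariant had already given `a` to Breaker.
      · exfalso
        refine haB (h.blocked U a hU haU' fun g hg => ?_)
        obtain ⟨hgU, hga⟩ := Finset.mem_sdiff.1 hg
        rw [Finset.mem_singleton] at hga
        by_cases hgf : g = f
        · subst hgf
          exact (Finset.mem_insert.1 hfM).resolve_left hga
        · refine (Finset.mem_insert.1 (hsubM ?_)).resolve_left hga
          simp [unmarkedEdges, hgU, hgf]
      · by_cases hfB : f ∈ B
        · exact Finset.mem_union_left _ hfB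
        · refine Finset.mem_union_right _ (hsub (Finset.mem_union_right _
            (Finset.mem_inter.2 ⟨Finset.mem_image.2 ⟨(U, f), ?_, rfl⟩, ?_⟩)))
          · simp only [hY, markedCliques, Finset.mem_filter, Finset.mem_univ, true_and]
            exact ⟨⟨hU, haU', hf⟩, hsubM⟩
          · refine (hfree _ _ f).2 ⟨?_, hfM, hfB⟩
            rw [hX, SimpleGraph.mem_edgeFinset, SimpleGraph.edgeSet_top]
            exact (mem_edgesWithin.1 hf).2
    · refine Finset.mem_union_left _ (h.blocked U f hU hf fun g hg => ?_)
      refine (Finset.mem_insert.1 (hsubM hg)).resolve_left ?_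
      rintro rfl
      exact haU hg
  · rw [Finset.disjoint_union_right]
    exact ⟨hdisj, (hFM.mono_left hSF).symm⟩

lemma BreakerSafe.not_makerWinsFrom (hk : 2 ≤ k) (hp : p = 1 / (1 + (q : ℝ)))
    (hΨ : Ψ < (1 + (q : ℝ)) ^ r) {M B : Finset (Sym2 (Fin n))} (h : BreakerSafe n k r p Ψ M B) :
    ¬ MakerWinsFrom (⊤ : SimpleGraph (Fin n)).edgeFinset (fun e => e)
      (fun M => ¬ (SimpleGraph.fromEdgeSet (M : Set (Sym2 (Fin n)))).CliqueFree k) (2 * q) M B := by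
  intro hwin
  induction hwin with
  | finished M B hend hgoal =>
    refine hgoal fun U hU => ?_
    have hall : ∀ g ∈ edgesWithin U, g ∈ M := by
      intro g
      induction g with
      | _ x y =>
        intro hg
        obtain ⟨hx, hy, hxy⟩ := mk_mem_edgesWithin.1 hg
        have := hU.isClique hx hy hxy
        rw [SimpleGraph.fromEdgeSet_adj] at this
        exact this.1
    have hne : (edgesWithin U).Nonempty := by
      rw [← Finset.card_pos, card_edgesWithin, hU.card_eq]
      exact Nat.choose_pos hk
    obtain ⟨f, hf⟩ := hne
    have hfB := h.blocked U f hU.card_eq hf fun g hg => hall g (Finset.mem_sdiff.1 hg).1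
    exact Finset.disjoint_left.1 h.disjoint (hall f hf) hfB
  | round M B a ha _ ih =>
    obtain ⟨S, hS, hcard, hsafe⟩ := h.exists_reply hp hΨ ha
    exact ih S hS hcard hsafe

/-- Breaker wins the `(1 : 2q)` clique game if the bias is large enough. -/
lemma not_cliqueGameMakersWin {s c : ℝ} {z : ℕ} (hs : 0 < s) (hsq : s ^ 2 = 1 / (1 + (q : ℝ)))
    (hc1 : c ≤ 1) (hn : n * s ^ (k + 1) ≤ c) (hk : 3 ≤ k)
    (hsmall : (k : ℝ) ^ 2 * (c + k * ((z : ℝ) ^ k * s)) ≤ 1 / 2) (hz : 2 + k * r ≤ z)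
    (hr : (1 + (q : ℝ)) * (n + 1) ^ 2 < 2 ^ r) :
    ¬ CliqueGameMakersWin k n (2 * q) := by
  have hq : (0 : ℝ) < 1 + q := by positivity
  have hs1 : s ≤ 1 := by
    by_contra! hcon
    have h1 : 1 < s ^ 2 := one_lt_pow₀ hcon (by norm_num)
    rw [hsq, lt_div_iff₀ hq] at h1
    have : (0 : ℝ) ≤ q := by positivity
    linarith
  have hpot : potential (threatEdges (n := n) (k := k) (r := r)) (s ^ 2) ∅ ∅ ≤
      (n + 1) ^ 2 * ((1 + q) / 2) ^ r := by
    have h1 : potential (threatEdges (n := n) (k := k) (r := r)) (s ^ 2) ∅ ∅ =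
        ∑ e : Sym2 (Fin n), ∑ τ : Fin r → markedCliques n k e,
          (s ^ 2) ^ (tupleEdges τ).card := by
      rw [potential, Fintype.sum_sigma]
      simp [threatEdges]
    rw [h1]
    calc _ ≤ ∑ e : Sym2 (Fin n), ((1 + (q : ℝ)) / 2) ^ r := by
          refine Finset.sum_le_sum fun e _ => ?_
          refine (sum_tuples_le hs hs1 hc1 hn hk hsmall e r hz).trans (le_of_eq ?_)
          rw [hsq]
          congr 1
          field_simp
      _ ≤ _ := by
          rw [Finset.sum_const, nsmul_eq_mul, Finset.card_univ, Sym2.card, Fintype.card_fin]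
          gcongr
          have : (n + 1).choose 2 ≤ (n + 1) ^ 2 := Nat.choose_le_pow _ _
          exact_mod_cast this
  refine (breakerSafe_empty hk hsq (mul_le_mul_of_nonneg_left hpot hq.le)).not_makerWinsFrom
    (by omega) hsq ?_
  rw [div_pow]
  calc (1 + (q : ℝ)) * ((n + 1) ^ 2 * ((1 + q) ^ r / 2 ^ r)) =
        (1 + (q : ℝ)) ^ r * (((1 + (q : ℝ)) * (n + 1) ^ 2) / 2 ^ r) := by ring
    _ < (1 + (q : ℝ)) ^ r * 1 := by
        gcongr
        rwa [div_lt_one (by positivity)]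
    _ = _ := mul_one _

end Breaker

/-! ### Two counting facts -/

section Counting

lemma card_filter_eq_on {ι A : Type*} [Fintype ι] [DecidableEq ι] [Fintype A] [DecidableEq A]
    (S : Finset ι) (g : ι → A) :
    (Finset.univ.filter fun ω : ι → A => ∀ i ∈ S, ω i = g i).card =
      Fintype.card A ^ (Fintype.card ι - S.card) := by
  have h : (Finset.univ.filter fun ω : ι → A => ∀ i ∈ S, ω i = g i) =
      Fintype.piFinset fun i => if i ∈ S then {g i} else Finset.univ := by
    ext ω
    simp only [Finset.mem_filter, Finset.mem_univ, true_and, Fintype.mem_piFinset]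
    refine forall_congr' fun i => ?_
    by_cases hi : i ∈ S <;> simp [hi]
  rw [h, Fintype.card_piFinset]
  have h2 : ∀ i, (if i ∈ S then {g i} else (Finset.univ : Finset A)).card =
      if i ∈ S then 1 else Fintype.card A := by
    intro i
    split_ifs <;> simp
  rw [Finset.prod_congr rfl fun i _ => h2 i, Finset.prod_ite]
  simp only [Finset.prod_const, one_pow, one_mul]
  congr 1
  rw [Finset.filter_not, Finset.card_sdiff_of_subset (Finset.filter_subset _ _)]
  simp

/-- Keep one representative per value of `f`; every discarded element collides with its
representative. -/
lemma card_le_card_add_card_collisions {α β : Type*} [DecidableEq α] [DecidableEq β]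
    {s : Finset α} {t : Finset β} (f : α → β) (hf : ∀ a ∈ s, f a ∈ t) :
    s.card ≤ t.card + ((s ×ˢ s).filter fun x => x.1 ≠ x.2 ∧ f x.1 = f x.2).card := by
  obtain ⟨u, hus, himg, hinj⟩ : ∃ u ⊆ s, u.image f = s.image f ∧ Set.InjOn f u := by
    obtain ⟨u, hu, h1, h2⟩ := Finset.exists_subset_injOn_image_eq_of_surjOn (s := (s : Set α))
      (t := s.image f) (f := f) (by simp [Set.SurjOn])
    exact ⟨u, by exact_mod_cast hu, h2, h1⟩
  have hrep : ∀ a ∈ s, ∃ a' ∈ u, f a' = f a := by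
    intro a ha
    have : f a ∈ u.image f := himg ▸ Finset.mem_image_of_mem f ha
    simpa using this
  choose! rep hrep1 hrep2 using hrep
  have h1 : u.card ≤ t.card := Finset.card_le_card_of_injOn f (fun a ha => hf a (hus ha)) hinj
  have h2 : (s \ u).card ≤
      ((s ×ˢ s).filter fun x => x.1 ≠ x.2 ∧ f x.1 = f x.2).card := by
    refine Finset.card_le_card_of_injOn (fun a => (a, rep a)) (fun a ha => ?_)
      (fun a _ a' _ h => (Prod.mk.inj h).1)
    obtain ⟨has, hau⟩ := Finset.mem_sdiff.1 (Finset.mem_coe.1 ha)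
    rw [Finset.mem_coe, Finset.mem_filter]
    refine ⟨Finset.mem_product.2 ⟨has, hus (hrep1 a has)⟩, ?_, (hrep2 a has).symm⟩
    intro h
    exact hau ((show a = rep a from h) ▸ hrep1 a has)
  have := Finset.card_sdiff_add_card_eq_card hus
  omega

end Counting

/-! ### First and second moments for copies of T in the random sample -/

section Copies

open scoped Classical

variable {V : Type*} [Fintype V] {T : Digraph V} {N m : ℕ}

/-- The directed edges of a digraph. -/
abbrev Digraph.Arc (T : Digraph V) : Type _ := {a : V × V // T.Adj a.1 a.2}

/-- A sample assigns a pair of numbers to each arc of `T` at each of `m` times. -/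
abbrev ArcSample (T : Digraph V) (N m : ℕ) : Type _ := T.Arc × Fin m → Fin N × Fin N

/-- A potential copy of `T`: a choice of a vertex in each of the parts (which have size `N`), and
of the times at which its edges are claimed. -/
abbrev TimedCopy (T : Digraph V) (N m : ℕ) : Type _ := (V → Fin N) × (T.Arc → Fin m)

/-- The copy `c` is present in the sample `ω`. -/
def TimedCopy.Present (ω : ArcSample T N m) (c : TimedCopy T N m) : Prop :=
  ∀ e : T.Arc, ω (e, c.2 e) = (c.1 e.1.1, c.1 e.1.2)

/-- The arcs of two copies that are claimed simultaneously. -/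
noncomputable def TimedCopy.agree (c c' : TimedCopy T N m) : Finset T.Arc :=
  Finset.univ.filter fun e => c.2 e = c'.2 e

/-- The moves on which a copy depends. -/
noncomputable def TimedCopy.support (c : TimedCopy T N m) : Finset (T.Arc × Fin m) :=
  Finset.univ.image fun e => (e, c.2 e)

/-- The vertices covered by a set of arcs. -/
noncomputable def arcVertices (S : Finset T.Arc) : Finset V :=
  Finset.univ.filter fun v => ∃ e ∈ S, e.1.1 = v ∨ e.1.2 = v

/-- The copies present in a sample. -/
noncomputable def presentCopies (ω : ArcSample T N m) : Finset (TimedCopy T N m) :=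
  Finset.univ.filter fun c => c.Present ω

/-- The pairs of distinct copies present in a sample that share a move. -/
noncomputable def conflictPairs (ω : ArcSample T N m) :
    Finset (TimedCopy T N m × TimedCopy T N m) :=
  Finset.univ.filter fun x => (x.1.Present ω ∧ x.2.Present ω) ∧ x.1 ≠ x.2 ∧
    (x.1.agree x.2).Nonempty

lemma TimedCopy.card_support (c : TimedCopy T N m) : c.support.card = Fintype.card T.Arc := by
  rw [support, Finset.card_image_of_injective _ fun e e' h => (Prod.mk.inj h).1,
    Finset.card_univ]

lemma TimedCopy.card_support_union (c c' : TimedCopy T N m) :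
    (c.support ∪ c'.support).card =
      Fintype.card T.Arc + (Fintype.card T.Arc - (c.agree c').card) := by
  have h1 : (c.support ∩ c'.support).card = (c.agree c').card := by
    have : c.support ∩ c'.support = (c.agree c').image fun e => (e, c.2 e) := by
      ext ⟨e, i⟩
      simp only [support, agree, Finset.mem_inter, Finset.mem_image, Finset.mem_univ, true_and,
        Prod.mk.injEq, exists_eq_left, Finset.mem_filter]
      constructor
      · rintro ⟨h₁, h₂⟩
        exact ⟨e, h₁.trans h₂.symm, rfl, h₁⟩
      · rintro ⟨e₁, h, rfl, h₁⟩
        exact ⟨h₁, h.symm.trans h₁⟩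
    rw [this, Finset.card_image_of_injective _ fun e e' h => (Prod.mk.inj h).1]
  have h2 := Finset.card_union_add_card_inter c.support c'.support
  rw [h1, c.card_support, c'.card_support] at h2
  have h3 : (c.agree c').card ≤ Fintype.card T.Arc := Finset.card_le_univ _
  omega

lemma TimedCopy.present_iff_of_present {ω₀ : ArcSample T N m} {c : TimedCopy T N m}
    (h : c.Present ω₀) (ω : ArcSample T N m) :
    c.Present ω ↔ ∀ i ∈ c.support, ω i = ω₀ i := by
  simp only [support, Finset.mem_image, Finset.mem_univ, true_and, forall_exists_index,
    forall_apply_eq_imp_iff, Present]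
  exact forall_congr' fun e => by rw [h e]

lemma pow_sub_eq_mul_inv_pow {P a d : ℕ} (hP : 0 < P) (h : d ≤ a) :
    ((P ^ (a - d) : ℕ) : ℝ) = (P : ℝ) ^ a * ((P : ℝ)⁻¹) ^ d := by
  have : (P : ℝ) ≠ 0 := by exact_mod_cast hP.ne'
  rw [Nat.cast_pow, pow_sub₀ _ this h, inv_pow]

lemma TimedCopy.card_present (hN : 0 < N) (c : TimedCopy T N m) :
    ((Finset.univ.filter fun ω => c.Present ω).card : ℝ) =
      ((N * N : ℕ) : ℝ) ^ Fintype.card (T.Arc × Fin m) *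
        (((N * N : ℕ) : ℝ)⁻¹) ^ Fintype.card T.Arc := by
  obtain ⟨ω₀, h₀⟩ : ∃ ω : ArcSample T N m, c.Present ω :=
    ⟨fun i => (c.1 i.1.1.1, c.1 i.1.1.2), fun _ => rfl⟩
  have : (Finset.univ.filter fun ω : ArcSample T N m => c.Present ω) =
      Finset.univ.filter fun ω : ArcSample T N m => ∀ i ∈ c.support, ω i = ω₀ i :=
    Finset.filter_congr fun ω _ => c.present_iff_of_present h₀ ω
  rw [this, card_filter_eq_on, Fintype.card_prod (Fin N), Fintype.card_fin, ← c.card_support,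
    pow_sub_eq_mul_inv_pow (by positivity) (Finset.card_le_univ _)]

/-- A shared move has a single sampled value, so two copies present together must agree at both ends
of each shared arc. The remaining samples are free. -/
lemma TimedCopy.card_present_pair_le (hN : 0 < N) (c c' : TimedCopy T N m) :
    ((Finset.univ.filter fun ω => c.Present ω ∧ c'.Present ω).card : ℝ) ≤
      if (∀ v ∈ arcVertices (c.agree c'), c'.1 v = c.1 v) then
        ((N * N : ℕ) : ℝ) ^ Fintype.card (T.Arc × Fin m) *
          (((N * N : ℕ) : ℝ)⁻¹) ^
            (Fintype.card T.Arc + (Fintype.card T.Arc - (c.agree c').card))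
      else 0 := by
  rcases (Finset.univ.filter fun ω => c.Present ω ∧ c'.Present ω).eq_empty_or_nonempty with
    he | ⟨ω₀, h₀⟩
  · rw [he, Finset.card_empty, Nat.cast_zero]
    split_ifs <;> positivity
  · obtain ⟨h₁, h₂⟩ := (Finset.mem_filter.1 h₀).2
    rw [if_pos]
    · have : (Finset.univ.filter fun ω : ArcSample T N m => c.Present ω ∧ c'.Present ω) =
          Finset.univ.filter fun ω : ArcSample T N m =>
            ∀ i ∈ c.support ∪ c'.support, ω i = ω₀ i := by
        refine Finset.filter_congr fun ω _ => ?_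
        rw [c.present_iff_of_present h₁, c'.present_iff_of_present h₂]
        simp only [Finset.mem_union, or_imp, forall_and]
      rw [this, card_filter_eq_on, Fintype.card_prod (Fin N), Fintype.card_fin,
        ← c.card_support_union c', pow_sub_eq_mul_inv_pow (by positivity) (Finset.card_le_univ _)]
    · intro v hv
      obtain ⟨e, he, hev⟩ := (Finset.mem_filter.1 hv).2
      have ht : c.2 e = c'.2 e := (Finset.mem_filter.1 he).2
      have h3 := h₁ e
      rw [ht, h₂ e, Prod.mk.injEq] at h3
      rcases hev with rfl | rfl
      · exact h3.1
      · exact h3.2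

lemma sum_card_presentCopies (hN : 0 < N) :
    ∑ ω : ArcSample T N m, ((presentCopies ω).card : ℝ) =
      ((N * N : ℕ) : ℝ) ^ Fintype.card (T.Arc × Fin m) *
        ((N : ℝ) ^ Fintype.card V * (m * ((N * N : ℕ) : ℝ)⁻¹) ^ Fintype.card T.Arc) := by
  have h1 : ∑ ω : ArcSample T N m, ((presentCopies ω).card : ℝ) =
      ∑ c : TimedCopy T N m, ((Finset.univ.filter fun ω => c.Present ω).card : ℝ) := by
    have := Finset.sum_card_bipartiteAbove_eq_sum_card_bipartiteBelow
      (s := (Finset.univ : Finset (ArcSample T N m)))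
      (t := (Finset.univ : Finset (TimedCopy T N m))) (fun ω c => c.Present ω)
    exact_mod_cast this
  rw [h1, Finset.sum_congr rfl fun c _ => c.card_present hN, Finset.sum_const, Finset.card_univ,
    nsmul_eq_mul, Fintype.card_prod, Fintype.card_fun, Fintype.card_fun, Fintype.card_fin,
    Fintype.card_fin, mul_pow]
  push_cast
  ring

lemma card_agreeing_pairs (S : Finset T.Arc) (Z : Finset V) :
    (Finset.univ.filter fun x : TimedCopy T N m × TimedCopy T N m =>
      (∀ v ∈ Z, x.2.1 v = x.1.1 v) ∧ ∀ e ∈ S, x.2.2 e = x.1.2 e).card =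
      (N ^ Fintype.card V * m ^ Fintype.card T.Arc) *
        (N ^ (Fintype.card V - Z.card) * m ^ (Fintype.card T.Arc - S.card)) := by
  have h1 : ∀ c : TimedCopy T N m, (Finset.univ.filter fun c' : TimedCopy T N m =>
      (∀ v ∈ Z, c'.1 v = c.1 v) ∧ ∀ e ∈ S, c'.2 e = c.2 e).card =
      N ^ (Fintype.card V - Z.card) * m ^ (Fintype.card T.Arc - S.card) := by
    intro c
    have : (Finset.univ.filter fun c' : TimedCopy T N m =>
        (∀ v ∈ Z, c'.1 v = c.1 v) ∧ ∀ e ∈ S, c'.2 e = c.2 e) =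
        (Finset.univ.filter fun φ : V → Fin N => ∀ v ∈ Z, φ v = c.1 v) ×ˢ
          (Finset.univ.filter fun t : T.Arc → Fin m => ∀ e ∈ S, t e = c.2 e) := by
      ext x
      simp
    rw [this, Finset.card_product, card_filter_eq_on, card_filter_eq_on, Fintype.card_fin,
      Fintype.card_fin]
  rw [Finset.card_filter, Fintype.sum_prod_type]
  simp_rw [← Finset.card_filter, h1]
  rw [Finset.sum_const, Finset.card_univ, Fintype.card_prod, Fintype.card_fun, Fintype.card_fun,
    Fintype.card_fin, Fintype.card_fin, smul_eq_mul]

/-- Pairs are grouped by their set `S` of shared arcs. Relative to the expected number of copies,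
the pairs for a given `S` contribute at most the ratio bounded by `η`, and there are at most `2 ^ E`
sets. -/
lemma sum_card_conflictPairs_le (hN : 0 < N) {η : ℝ} (hη0 : 0 ≤ η)
    (hcover : ∀ v : V, ∃ e : T.Arc,
      e.1.1 = v ∨ e.1.2 = v)
    (hη : ∀ S : Finset T.Arc, S.Nonempty → S ≠ Finset.univ →
      (N : ℝ) ^ (Fintype.card V - (arcVertices S).card) *
        (m * ((N * N : ℕ) : ℝ)⁻¹) ^ (Fintype.card T.Arc - S.card) ≤ η) :
    ∑ ω : ArcSample T N m, ((conflictPairs ω).card : ℝ) ≤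
      2 ^ Fintype.card T.Arc * η * (((N * N : ℕ) : ℝ) ^ Fintype.card (T.Arc × Fin m) *
        ((N : ℝ) ^ Fintype.card V * (m * ((N * N : ℕ) : ℝ)⁻¹) ^ Fintype.card T.Arc)) := by
  set E := Fintype.card T.Arc with hE
  set Q : ℝ := ((N * N : ℕ) : ℝ) ^ Fintype.card (T.Arc × Fin m) with hQ
  set w : ℝ := ((N * N : ℕ) : ℝ)⁻¹ with hw
  have hw0 : 0 ≤ w := by positivity
  have hQ0 : 0 ≤ Q := by positivity
  set 𝒮 : Finset (Finset T.Arc) := Finset.univ.filter fun S => S.Nonempty ∧ S ≠ Finset.univ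
    with h𝒮
  set rel : Finset T.Arc → TimedCopy T N m × TimedCopy T N m → Prop := fun S x =>
    (∀ v ∈ arcVertices S, x.2.1 v = x.1.1 v) ∧ ∀ e ∈ S, x.2.2 e = x.1.2 e with hrel
  have h1 : ∑ ω : ArcSample T N m, ((conflictPairs ω).card : ℝ) =
      ∑ x : TimedCopy T N m × TimedCopy T N m, ((Finset.univ.filter fun ω =>
        (x.1.Present ω ∧ x.2.Present ω) ∧ x.1 ≠ x.2 ∧ (x.1.agree x.2).Nonempty).card : ℝ) := by
    have := Finset.sum_card_bipartiteAbove_eq_sum_card_bipartiteBelow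
      (s := (Finset.univ : Finset (ArcSample T N m)))
      (t := (Finset.univ : Finset (TimedCopy T N m × TimedCopy T N m)))
      (fun ω x => (x.1.Present ω ∧ x.2.Present ω) ∧ x.1 ≠ x.2 ∧ (x.1.agree x.2).Nonempty)
    exact_mod_cast this
  have h2 : ∀ x : TimedCopy T N m × TimedCopy T N m, ((Finset.univ.filter fun ω =>
        (x.1.Present ω ∧ x.2.Present ω) ∧ x.1 ≠ x.2 ∧ (x.1.agree x.2).Nonempty).card : ℝ) ≤
      ∑ S ∈ 𝒮, if rel S x then Q * w ^ (E + (E - S.card)) else 0 := by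
    rintro ⟨c, c'⟩
    have hnn : ∀ S ∈ 𝒮, 0 ≤ if rel S (c, c') then Q * w ^ (E + (E - S.card)) else 0 := by
      intro S _
      split_ifs <;> positivity
    by_cases hc : c ≠ c' ∧ (c.agree c').Nonempty
    · have h3 : (Finset.univ.filter fun ω : ArcSample T N m =>
          (c.Present ω ∧ c'.Present ω) ∧ c ≠ c' ∧ (c.agree c').Nonempty) =
          Finset.univ.filter fun ω => c.Present ω ∧ c'.Present ω :=
        Finset.filter_congr fun ω _ => by simp only [hc, and_true, ne_eq, not_false_eq_true]
      simp only [h3]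
      refine (c.card_present_pair_le hN c').trans ?_
      split_ifs with hv
      · have hr : rel (c.agree c') (c, c') :=
          ⟨hv, fun e he => (Finset.mem_filter.1 he).2.symm⟩
        have hS : c.agree c' ∈ 𝒮 := by
          -- Sharing every arc forces equal times and, as arcs cover all vertices, equal vertices.
          refine Finset.mem_filter.2 ⟨Finset.mem_univ _, hc.2, fun hu => hc.1 ?_⟩
          refine Prod.ext (funext fun v => ?_) (funext fun e => ?_)
          · obtain ⟨e, he⟩ := hcover v
            refine (hv v (Finset.mem_filter.2 ⟨Finset.mem_univ _, e, ?_, he⟩)).symm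
            rw [hu]
            exact Finset.mem_univ e
          · have : e ∈ c.agree c' := by
              rw [hu]
              exact Finset.mem_univ e
            exact (Finset.mem_filter.1 this).2
        have := Finset.single_le_sum hnn hS
        rwa [if_pos hr] at this
      · exact Finset.sum_nonneg hnn
    · have h3 : (Finset.univ.filter fun ω : ArcSample T N m =>
          (c.Present ω ∧ c'.Present ω) ∧ c ≠ c' ∧ (c.agree c').Nonempty) = ∅ :=
        Finset.filter_eq_empty_iff.2 fun ω _ h => hc h.2
      simp only [h3, Finset.card_empty, Nat.cast_zero]
      exact Finset.sum_nonneg hnn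
  rw [h1]
  refine (Finset.sum_le_sum fun x _ => h2 x).trans ?_
  rw [Finset.sum_comm]
  have h4 : ∀ S ∈ 𝒮, ∑ x : TimedCopy T N m × TimedCopy T N m,
      (if rel S x then Q * w ^ (E + (E - S.card)) else 0) ≤
      η * (Q * ((N : ℝ) ^ Fintype.card V * (m * w) ^ E)) := by
    intro S hS
    obtain ⟨hS1, hS2⟩ := (Finset.mem_filter.1 hS).2
    rw [← Finset.sum_filter, Finset.sum_const, nsmul_eq_mul, card_agreeing_pairs]
    have : (((N ^ Fintype.card V * m ^ E) * (N ^ (Fintype.card V - (arcVertices S).card) *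
        m ^ (E - S.card)) : ℕ) : ℝ) * (Q * w ^ (E + (E - S.card))) =
        ((N : ℝ) ^ (Fintype.card V - (arcVertices S).card) * (m * w) ^ (E - S.card)) *
          (Q * ((N : ℝ) ^ Fintype.card V * (m * w) ^ E)) := by
      push_cast
      rw [mul_pow, mul_pow, pow_add]
      ring
    rw [this]
    exact mul_le_mul_of_nonneg_right (hη S hS1 hS2) (by positivity)
  refine (Finset.sum_le_sum h4).trans ?_
  rw [Finset.sum_const, nsmul_eq_mul, ← mul_assoc]
  gcongr
  have : 𝒮.card ≤ 2 ^ E := by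
    rw [hE, ← Fintype.card_finset]
    exact Finset.card_le_univ _
  exact_mod_cast this

end Copies

/-! ### Maker wins by random play -/

section MakerWins

open scoped Classical

variable {V : Type*} [Fintype V] {T : Digraph V} {N m : ℕ}

/-- Otherwise each present copy uses a bad move. Assigning one to each copy, two copies with the
same bad move form a conflict pair, so there would be at most `bad.card` plus the number of conflict
pairs. -/
lemma exists_good_copy (ω : ArcSample T N m) (bad : Finset (T.Arc × Fin m))
    (h : bad.card + (conflictPairs ω).card < (presentCopies ω).card) :
    ∃ c : TimedCopy T N m, c.Present ω ∧ ∀ e, (e, c.2 e) ∉ bad := by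
  by_contra! hcon
  rcases (presentCopies ω).eq_empty_or_nonempty with he | ⟨c₀, hc₀⟩
  · simp [he] at h
  have : Nonempty T.Arc := ⟨(hcon c₀ (Finset.mem_filter.1 hc₀).2).choose⟩
  choose! arc harc using hcon
  have hp : ∀ c ∈ presentCopies ω, c.Present ω := fun c hc => (Finset.mem_filter.1 hc).2
  have h1 := card_le_card_add_card_collisions (s := presentCopies ω) (t := bad)
    (fun c => (arc c, c.2 (arc c))) fun c hc => harc c (hp c hc)
  have h2 : ((presentCopies ω ×ˢ presentCopies ω).filter fun x => x.1 ≠ x.2 ∧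
      (arc x.1, x.1.2 (arc x.1)) = (arc x.2, x.2.2 (arc x.2))) ⊆ conflictPairs ω := by
    rintro ⟨c, c'⟩ hx
    obtain ⟨hcc, hne, heq⟩ := Finset.mem_filter.1 hx
    obtain ⟨hc, hc'⟩ := Finset.mem_product.1 hcc
    obtain ⟨h3, h4⟩ := Prod.mk.inj heq
    refine Finset.mem_filter.2 ⟨Finset.mem_univ _, ⟨hp c hc, hp c' hc'⟩, hne, arc c,
      Finset.mem_filter.2 ⟨Finset.mem_univ _, ?_⟩⟩
    rw [← h3] at h4
    exact h4
  have := Finset.card_le_card h2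
  omega

/-- Random play shows that Maker wins the tournament game. -/
lemma tournamentGameMakersWin_of_density {n b : ℕ} {η : ℝ} (hT : T.IsTournament) (hN : 0 < N)
    (hn : Fintype.card V * N ≤ n) (hη0 : 0 ≤ η)
    (hcover : ∀ v : V, ∃ e : T.Arc, e.1.1 = v ∨ e.1.2 = v)
    (hη : ∀ S : Finset T.Arc, S.Nonempty → S ≠ Finset.univ →
      (N : ℝ) ^ (Fintype.card V - (arcVertices S).card) *
        (m * ((N * N : ℕ) : ℝ)⁻¹) ^ (Fintype.card T.Arc - S.card) ≤ η)
    (hη2 : 2 ^ Fintype.card T.Arc * η ≤ 1 / 2)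
    (hb : ((Fintype.card T.Arc * m : ℕ) : ℝ) ^ 2 * (b + 1) * ((N * N : ℕ) : ℝ)⁻¹ <
      1 / 2 * ((N : ℝ) ^ Fintype.card V * (m * ((N * N : ℕ) : ℝ)⁻¹) ^ Fintype.card T.Arc)) :
    TournamentGameMakersWin T n b := by
  have hmono : ∀ M M' : Finset (Fin n × Fin n), M ⊆ M' → ContainsCopy T M →
      ContainsCopy T M' := fun M M' h ⟨f, hf⟩ => ⟨f, fun u v huv => h (hf u v huv)⟩
  have hπ : ∀ x ∈ (⊤ : SimpleGraph (Fin n)).edgeFinset,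
      ∃ a : Fin n × Fin n, s(a.1, a.2) = x := by
    intro x _
    induction x with
    | _ x y => exact ⟨(x, y), rfl⟩
  by_contra hlose
  obtain ⟨emb⟩ : Nonempty (V × Fin N ↪ Fin n) :=
    Function.Embedding.nonempty_of_card_le (by simpa using hn)
  set L := Fintype.card (T.Arc × Fin m) with hL
  have hLm : L = Fintype.card T.Arc * m := by simp [hL]
  set eqv : T.Arc × Fin m ≃ Fin L := Fintype.equivFin _ with heqv
  have : Nonempty (Fin N × Fin N) := ⟨(⟨0, hN⟩, ⟨0, hN⟩)⟩
  set cl : Fin L → Fin N × Fin N → Fin n × Fin n := fun i a =>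
    (emb ((eqv.symm i).1.1.1, a.1), emb ((eqv.symm i).1.1.2, a.2)) with hcl
  have hne : ∀ e : T.Arc, e.1.1 ≠ e.1.2 := by
    rintro ⟨⟨u, v⟩, h⟩ (rfl : u = v)
    exact hT.1 u h
  have hinj : ∀ i, Function.Injective fun a => s((cl i a).1, (cl i a).2) := by
    rintro i ⟨x, y⟩ ⟨x', y'⟩ h
    rcases Sym2.eq_iff.1 h with ⟨h1, h2⟩ | ⟨h1, h2⟩
    · have h3 := emb.injective h1
      have h4 := emb.injective h2
      simp only [Prod.mk.injEq, true_and] at h3 h4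
      rw [h3, h4]
    · have h3 := emb.injective h1
      simp only [Prod.mk.injEq] at h3
      exact (hne _ h3.1).elim
  have hX : ∀ i a, s((cl i a).1, (cl i a).2) ∈ (⊤ : SimpleGraph (Fin n)).edgeFinset := by
    intro i a
    rw [SimpleGraph.mem_edgeFinset, SimpleGraph.mem_edgeSet, SimpleGraph.top_adj]
    intro h
    have := emb.injective h
    simp only [Prod.mk.injEq] at this
    exact hne _ this.1
  set P : ℝ := ((N * N : ℕ) : ℝ) with hP
  have hP0 : 0 < P := by
    exact Nat.cast_pos.2 (by positivity)
  have hcardA : (Fintype.card (Fin N × Fin N) : ℝ) = P := by simp [hP]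
  -- At most `L` rounds are played and each occupies at most `b + 1` edges, out of `P` between two
  -- parts.
  set ε : ℝ := ((L * (b + 1) : ℕ) : ℝ) * P⁻¹ with hεdef
  have hε : ((L * (b + 1) : ℕ) : ℝ) ≤ ε * Fintype.card (Fin N × Fin N) := by
    rw [hcardA, hεdef, inv_mul_cancel_right₀ hP0.ne']
  set c : ℝ := 1 / 2 * ((N : ℝ) ^ Fintype.card V * (m * P⁻¹) ^ Fintype.card T.Arc) with hc
  set reidx : (Fin L → Fin N × Fin N) ≃ ArcSample T N m :=
    eqv.symm.arrowCongr (Equiv.refl _) with hreidx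
  obtain ⟨ω, bad, M', B', hl, -, hgood, hval⟩ := exists_sample_of_not_makerWinsFrom hε L cl
    hinj hX (fun ω => ((presentCopies (reidx ω)).card : ℝ) - (conflictPairs (reidx ω)).card) c
    (by
      rw [reidx.sum_comp fun ω : ArcSample T N m =>
        ((presentCopies ω).card : ℝ) - (conflictPairs ω).card, Finset.sum_sub_distrib,
        sum_card_presentCopies hN, hcardA]
      have h1 := sum_card_conflictPairs_le (m := m) hN hη0 hcover hη
      have h2 : 0 ≤ P ^ L * ((N : ℝ) ^ Fintype.card V * (m * P⁻¹) ^ Fintype.card T.Arc) := by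
        positivity
      have h3 := mul_le_mul_of_nonneg_right hη2 h2
      simp only [hc]
      linarith) ∅ ∅ hlose (by simp)
  have hlt : (L : ℝ) * ε < c := by
    refine lt_of_eq_of_lt ?_ hb
    rw [hεdef, ← hLm]
    push_cast
    ring
  have hcount : bad.card + (conflictPairs (reidx ω)).card < (presentCopies (reidx ω)).card := by
    have : (bad.card : ℝ) + (conflictPairs (reidx ω)).card < (presentCopies (reidx ω)).card := by
      linarith
    exact_mod_cast this
  obtain ⟨C, hC, hCgood⟩ := exists_good_copy (reidx ω) (bad.map eqv.symm.toEmbedding)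
    (by rwa [Finset.card_map])
  -- Distinct vertices of `T` lie in distinct parts, so the copy is automatically injective.
  refine hl (MakerWinsFrom.of_goal hmono hπ B' ⟨⟨fun v => emb (v, C.1 v), fun v v' h => ?_⟩, ?_⟩)
  · exact (Prod.mk.inj (emb.injective h)).1
  · intro u v huv
    set e : T.Arc := ⟨(u, v), huv⟩ with he
    have h1 : eqv (e, C.2 e) ∉ bad := by
      intro h
      refine hCgood e (Finset.mem_map.2 ⟨_, h, ?_⟩)
      simp
    have h2 := hgood _ h1
    have h3 : ω (eqv (e, C.2 e)) = (C.1 u, C.1 v) := hC e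
    simp only [hcl, Equiv.symm_apply_apply, h3] at h2
    exact h2

end MakerWins

/-! ### Choice of parameters for Breaker -/

section BreakerBias

lemma tendsto_log_pow_div_sqrt (K : ℝ) (hK : 0 ≤ K) (k : ℕ) :
    Tendsto (fun l : ℕ => (2 + K * ((l : ℝ) + 1)) ^ k / (√2) ^ l) atTop (nhds 0) := by
  have h2 : (1 : ℝ) < √2 := by
    rw [Real.lt_sqrt] <;> norm_num
  have h := (tendsto_pow_const_div_const_pow_of_one_lt k h2).const_mul ((2 + 2 * K) ^ k)
  rw [mul_zero] at h
  refine squeeze_zero' (Eventually.of_forall fun l => by positivity) ?_ h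
  filter_upwards [eventually_ge_atTop 1] with l hl
  have hl' : (1 : ℝ) ≤ l := by exact_mod_cast hl
  rw [← mul_div_assoc, ← mul_pow]
  gcongr
  nlinarith

/-- Breaker wins every clique game with sufficiently large bias. -/
lemma exists_not_cliqueGameMakersWin {k : ℕ} (hk : 3 ≤ k) :
    ∃ q₀ : ℕ, ∀ n q : ℕ, q₀ ≤ q →
      (n : ℝ) ^ 2 ≤ (1 / (4 * (k : ℝ) ^ 2)) ^ 2 * (1 + (q : ℝ)) ^ (k + 1) →
      ¬ CliqueGameMakersWin k n (2 * q) := by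
  set c : ℝ := 1 / (4 * (k : ℝ) ^ 2) with hc
  have hk0 : (0 : ℝ) < k := by exact_mod_cast (by omega : 0 < k)
  have hk1 : (1 : ℝ) ≤ k := by exact_mod_cast (by omega : 1 ≤ k)
  have hc0 : 0 < c := by positivity
  have hc1 : c ≤ 1 := by
    rw [hc, div_le_one (by positivity)]
    nlinarith
  set K : ℕ := k * (2 * k + 3) with hK
  have hlim := tendsto_log_pow_div_sqrt (K : ℝ) (by positivity) k
  have hev : ∀ᶠ l : ℕ in atTop, (2 + (K : ℝ) * ((l : ℝ) + 1)) ^ k / (√2) ^ l ≤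
      1 / (4 * (k : ℝ) ^ 3) :=
    hlim.eventually_le_const (by positivity)
  obtain ⟨l₀, hl₀⟩ := eventually_atTop.1 hev
  refine ⟨2 ^ l₀, fun n q hq hn => ?_⟩
  set Q : ℝ := 1 + (q : ℝ) with hQ
  have hQ1 : 1 ≤ Q := by
    rw [hQ]
    have : (0 : ℝ) ≤ q := by positivity
    linarith
  set l := Nat.log 2 (q + 1) with hl
  have hl0 : l₀ ≤ l := (Nat.le_log_iff_pow_le (by norm_num) (by omega)).2 (by omega)
  have hlq : (2 : ℝ) ^ l ≤ Q := by
    have := Nat.pow_log_le_self 2 (x := q + 1) (by omega)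
    rw [hQ, add_comm]
    exact_mod_cast this
  set s : ℝ := (√Q)⁻¹ with hs
  have hs0 : 0 < s := by positivity
  have hsq : s ^ 2 = 1 / (1 + (q : ℝ)) := by
    rw [hs, inv_pow, Real.sq_sqrt (by positivity), one_div]
  have hsl : s ≤ ((√2) ^ l)⁻¹ := by
    rw [hs]
    gcongr
    refine Real.le_sqrt_of_sq_le ?_
    rw [← pow_mul, mul_comm, pow_mul, Real.sq_sqrt (by norm_num)]
    exact hlq
  have hns : n * s ^ (k + 1) ≤ c := by
    refine le_of_sq_le_sq ?_ hc0.le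
    rw [mul_pow, ← pow_mul, mul_comm (k + 1), pow_mul, hsq, one_div, inv_pow, ← div_eq_mul_inv,
      div_le_iff₀ (by positivity)]
    exact hn
  -- `r` is logarithmic in `q`, and `z = 2 + k * r` is the number of vertices that a tuple may
  -- touch; `z ^ k * s` still tends to 0.
  refine not_cliqueGameMakersWin (z := 2 + K * (l + 1)) (r := (2 * k + 3) * (l + 1)) hs0 hsq hc1
    hns hk ?_ ?_ ?_
  · have h1 : (((2 + K * (l + 1) : ℕ) : ℝ)) ^ k * s ≤ 1 / (4 * (k : ℝ) ^ 3) := by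
      refine le_trans ?_ (hl₀ l hl0)
      rw [div_eq_mul_inv]
      push_cast
      gcongr
    -- Each of the two summands contributes at most 1/4.
    calc (k : ℝ) ^ 2 * (c + k * (((2 + K * (l + 1) : ℕ) : ℝ) ^ k * s)) ≤
          (k : ℝ) ^ 2 * (c + k * (1 / (4 * (k : ℝ) ^ 3))) := by gcongr
      _ = 1 / 2 := by
          rw [hc]
          field_simp
          norm_num
  · rw [hK, mul_assoc]
  · have h1 : (n : ℝ) ≤ Q ^ (k + 1) - 1 := by
      rcases Nat.eq_zero_or_pos n with rfl | hn0
      · have := one_le_pow₀ (n := k + 1) hQ1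
        simp only [Nat.cast_zero]
        linarith
      · have h1 : (1 : ℝ) ≤ n := by exact_mod_cast hn0
        have h2 : c ^ 2 ≤ 1 / 2 := by
          have : c ≤ 1 / 2 := by
            rw [hc]
            gcongr
            nlinarith
          nlinarith
        have h3 : c ^ 2 * Q ^ (k + 1) ≤ 1 / 2 * Q ^ (k + 1) := by gcongr
        nlinarith
    have h2 : Q < 2 ^ (l + 1) := by
      have := Nat.lt_pow_succ_log_self (b := 2) (by norm_num) (q + 1)
      rw [hQ, add_comm]
      exact_mod_cast this
    calc (1 + (q : ℝ)) * (n + 1) ^ 2 ≤ Q * (Q ^ (k + 1)) ^ 2 := by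
          gcongr
          linarith
      _ = Q ^ (2 * k + 3) := by ring
      _ < (2 ^ (l + 1)) ^ (2 * k + 3) := by
          gcongr
      _ = _ := by rw [← pow_mul, mul_comm]

end BreakerBias

/-! ### Choice of parameters for Maker -/

section MakerBias

open scoped Classical

variable {V : Type*} [Fintype V] {T : Digraph V}

/-- Arcs and their reversals are distinct ordered pairs, because a tournament has no 2-cycles. -/
lemma two_mul_card_arcs_le (hT : T.IsTournament) (S : Finset T.Arc) :
    2 * S.card ≤ (arcVertices S).card * ((arcVertices S).card - 1) := by
  set f : T.Arc ⊕ T.Arc → V × V := Sum.elim (fun e => e.1) (fun e => e.1.swap) with hf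
  have hxor : ∀ u v, T.Adj u v → ¬ T.Adj v u := by
    intro u v h h'
    have hne : u ≠ v := by
      rintro rfl
      exact hT.1 u h
    rcases hT.2 u v hne with ⟨_, h2⟩ | ⟨_, h2⟩
    · exact h2 h'
    · exact h2 h
  have hinj : Function.Injective f := by
    rintro (⟨⟨u, v⟩, h⟩ | ⟨⟨u, v⟩, h⟩) (⟨⟨u', v'⟩, h'⟩ | ⟨⟨u', v'⟩, h'⟩) heq
    all_goals
      simp only [hf, Sum.elim_inl, Sum.elim_inr, Prod.swap_prod_mk, Prod.mk.injEq] at heq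
      obtain ⟨rfl, rfl⟩ := heq
    · rfl
    · exact (hxor _ _ h h').elim
    · exact (hxor _ _ h h').elim
    · rfl
  have h1 : (S.disjSum S).card ≤ (arcVertices S).offDiag.card := by
    refine Finset.card_le_card_of_injOn f ?_ hinj.injOn
    have hmem : ∀ e ∈ S, e.1.1 ∈ arcVertices S ∧ e.1.2 ∈ arcVertices S ∧ e.1.1 ≠ e.1.2 := by
      intro e he
      refine ⟨Finset.mem_filter.2 ⟨Finset.mem_univ _, e, he, Or.inl rfl⟩,
        Finset.mem_filter.2 ⟨Finset.mem_univ _, e, he, Or.inr rfl⟩, fun h => hT.1 e.1.1 ?_⟩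
      have := e.2
      rwa [← h] at this
    intro x hx
    rw [Finset.mem_coe, Finset.mem_disjSum] at hx
    rw [Finset.mem_coe, Finset.mem_offDiag]
    rcases hx with ⟨e, he, rfl⟩ | ⟨e, he, rfl⟩
    · exact hmem e he
    · exact ⟨(hmem e he).2.1, (hmem e he).1, (hmem e he).2.2.symm⟩
  rwa [Finset.card_disjSum, ← two_mul, Finset.offDiag_card, ← Nat.mul_sub_one] at h1

lemma two_mul_card_arc (hT : T.IsTournament) :
    2 * Fintype.card T.Arc = Fintype.card V * (Fintype.card V - 1) := by
  refine le_antisymm ?_ ?_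
  · refine (two_mul_card_arcs_le hT Finset.univ).trans ?_
    have := Finset.card_le_univ (arcVertices (Finset.univ : Finset T.Arc))
    gcongr
  · have h1 : ((Finset.univ : Finset V).offDiag).card ≤
        ((Finset.univ : Finset T.Arc).image (fun e => e.1) ∪
          (Finset.univ : Finset T.Arc).image fun e => e.1.swap).card := by
      refine Finset.card_le_card ?_
      rintro ⟨u, v⟩ huv
      rw [Finset.mem_offDiag] at huv
      rw [Finset.mem_union, Finset.mem_image, Finset.mem_image]
      rcases hT.2 u v huv.2.2 with ⟨h, _⟩ | ⟨h, _⟩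
      · exact Or.inl ⟨⟨(u, v), h⟩, Finset.mem_univ _, rfl⟩
      · exact Or.inr ⟨⟨(v, u), h⟩, Finset.mem_univ _, rfl⟩
    rw [Finset.offDiag_card, ← Nat.mul_sub_one, Finset.card_univ] at h1
    refine h1.trans ((Finset.card_union_le _ _).trans ?_)
    rw [two_mul]
    exact add_le_add Finset.card_image_le Finset.card_image_le

lemma two_le_card_arcVertices (hT : T.IsTournament) {S : Finset T.Arc} (hS : S.Nonempty) :
    2 ≤ (arcVertices S).card := by
  have h1 := two_mul_card_arcs_le hT S
  have h2 := hS.card_pos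
  by_contra! h
  interval_cases (arcVertices S).card <;> omega

lemma exists_arc (hT : T.IsTournament) (hV : 2 ≤ Fintype.card V) (v : V) :
    ∃ e : T.Arc, e.1.1 = v ∨ e.1.2 = v := by
  have : Nontrivial V := Fintype.one_lt_card_iff_nontrivial.1 hV
  obtain ⟨u, hu⟩ := exists_ne v
  rcases hT.2 u v hu with ⟨h, _⟩ | ⟨h, _⟩
  · exact ⟨⟨(u, v), h⟩, Or.inr rfl⟩
  · exact ⟨⟨(v, u), h⟩, Or.inl rfl⟩

lemma tournamentGameMakersWin_of_sparse {k N m n b : ℕ} {s η : ℝ} (hT : T.IsTournament)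
    (hV : Fintype.card V = k) (hk : 3 ≤ k) (hN : 0 < N) (hn : k * N ≤ n) (hs : 0 < s)
    (hsm : s ^ 2 = m * ((N * N : ℕ) : ℝ)⁻¹) (hη1 : η ≤ 1) (hsη : s ^ 2 ≤ η)
    (hx : N * s ^ (k + 1) ≤ η) (hη2 : 2 ^ Fintype.card T.Arc * η ≤ 1 / 2)
    (hb : 2 * (Fintype.card T.Arc : ℝ) ^ 2 * s ^ 2 * (b + 1) < (N * s ^ (k + 1)) ^ (k - 2)) :
    TournamentGameMakersWin T n b := by
  have hη0 : 0 ≤ η := le_trans (by positivity) hsη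
  have hs1 : s ≤ 1 := by
    by_contra! h
    have := one_lt_pow₀ h (n := 2) (by norm_num)
    linarith
  have hE := two_mul_card_arc hT
  rw [hV] at hE
  refine tournamentGameMakersWin_of_density (m := m) hT hN (by rwa [hV]) hη0
    (exists_arc hT (by omega)) ?_ hη2 ?_
  · intro S hS hSu
    rw [← hsm, hV]
    have h2 := two_le_card_arcVertices hT hS
    have h3 := two_mul_card_arcs_le hT S
    have hvk : (arcVertices S).card ≤ k := hV ▸ Finset.card_le_univ _
    have hlt : S.card < Fintype.card T.Arc := by
      rw [← Finset.card_univ]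
      exact Finset.card_lt_card (Finset.ssubset_univ_iff.2 hSu)
    set v := (arcVertices S).card
    rcases hvk.lt_or_eq with hlt' | heq
    -- A set of arcs on `v < k` vertices misses at least as many arcs as the full subtournament on
    -- them does, so the ratio is at most `(N * s ^ (k + 1)) ^ (k - v)`. If `v = k`, at least one
    -- arc is missing, which gives a factor `s ^ 2`.
    · have h4 : (k + v - 1) * (k - v) ≤ 2 * (Fintype.card T.Arc - S.card) := by
        rw [← two_mul_choose_two_sub (by omega) hvk, Nat.mul_sub, two_mul_choose_two,
          two_mul_choose_two, ← hE]
        omega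
      calc (N : ℝ) ^ (k - v) * (s ^ 2) ^ (Fintype.card T.Arc - S.card)
          ≤ (N : ℝ) ^ (k - v) * (s ^ (k + 1)) ^ (k - v) := by
            rw [← pow_mul, ← pow_mul]
            refine mul_le_mul_of_nonneg_left (pow_le_pow_of_le_one hs.le hs1 ?_) (by positivity)
            refine le_trans (Nat.mul_le_mul_right _ ?_) h4
            omega
        _ = (N * s ^ (k + 1)) ^ (k - v) := (mul_pow _ _ _).symm
        _ ≤ N * s ^ (k + 1) :=
            pow_le_of_le_one (by positivity) (hx.trans hη1) (by omega)
        _ ≤ η := hx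
    · rw [heq, Nat.sub_self, pow_zero, one_mul]
      exact (pow_le_of_le_one (by positivity) (hsη.trans hη1) (by omega)).trans hsη
  · rw [← hsm, hV]
    have hN0 : (0 : ℝ) < N := by exact_mod_cast hN
    have hm : (m : ℝ) = s ^ 2 * N ^ 2 := by
      rw [hsm]
      push_cast
      field_simp
    -- This is k(k−1) = 2 + (k+1)(k−2).
    have h1 : (N : ℝ) ^ k * (s ^ 2) ^ Fintype.card T.Arc =
        N ^ 2 * s ^ 2 * (N * s ^ (k + 1)) ^ (k - 2) := by
      rw [← pow_mul, hE, mul_pow, ← pow_mul]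
      obtain ⟨j, rfl⟩ := Nat.exists_eq_add_of_le' (show 2 ≤ k by omega)
      have h2 : j + 2 - 2 = j := by omega
      have h3 : j + 2 - 1 = j + 1 := by omega
      rw [h2, h3]
      ring
    rw [h1]
    push_cast
    rw [hm]
    calc (Fintype.card T.Arc * (s ^ 2 * (N : ℝ) ^ 2)) ^ 2 * (b + 1) * ((N : ℝ) * N)⁻¹
        = 1 / 2 * (N ^ 2 * s ^ 2 *
            (2 * (Fintype.card T.Arc : ℝ) ^ 2 * s ^ 2 * (b + 1))) := by
          field_simp
      _ < _ := by gcongr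

/-- Maker wins the tournament game up to a bias of order `n ^ (2 / (k + 1))`. -/
lemma exists_tournamentGameMakersWin {k : ℕ} (hT : T.IsTournament) (hV : Fintype.card V = k)
    (hk : 3 ≤ k) :
    ∃ c : ℝ, 0 < c ∧ ∃ n₀ : ℕ, ∀ n b : ℕ, n₀ ≤ n → 1 ≤ b →
      (b : ℝ) ≤ c * (n : ℝ) ^ ((2 : ℝ) / ((k : ℝ) + 1)) → TournamentGameMakersWin T n b := by
  set E := Fintype.card T.Arc with hE
  have hE0 : 0 < E := by
    have := two_mul_card_arc hT
    rw [hV] at this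
    have : 0 < k * (k - 1) := Nat.mul_pos (by omega) (by omega)
    omega
  have hk0 : (0 : ℝ) < k := by exact_mod_cast (by omega : 0 < k)
  set α : ℝ := (2 : ℝ) / ((k : ℝ) + 1) with hα
  have hα0 : 0 < α := by positivity
  have hα1 : α ≤ 1 := by
    rw [hα, div_le_one (by positivity)]
    have : (3 : ℝ) ≤ k := by exact_mod_cast hk
    linarith
  set η : ℝ := 1 / 2 / 2 ^ E with hη
  have hη0 : 0 < η := by positivity
  have hη1 : η ≤ 1 := by
    rw [hη, div_le_one (by positivity)]
    have := one_le_pow₀ (n := E) (one_le_two (α := ℝ))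
    linarith
  set κ : ℝ := (η / 2) ^ (k + 1) with hκ
  have hκ0 : 0 < κ := by positivity
  -- `κ` is a lower bound for `N * s ^ (k + 1)`. The 16 absorbs the factors 2, 2 and 2k in the final
  -- estimate and leaves 1/2 for strictness. The bound on `n` makes `η * N ≥ 1`, so that rounding
  -- `m` down loses at most a factor 2.
  refine ⟨κ ^ (k - 2) / (16 * k * E ^ 2 * η), by positivity, k * (⌈1 / η⌉₊ + 1),
    fun n b hn hb1 hb => ?_⟩
  set N := n / k with hNdef
  have hNge : ⌈1 / η⌉₊ + 1 ≤ N := by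
    rw [hNdef, Nat.le_div_iff_mul_le (by omega), mul_comm]
    exact hn
  have hN : 0 < N := by omega
  have hN0 : (0 : ℝ) < N := by exact_mod_cast hN
  have hN1 : (1 : ℝ) ≤ N := by exact_mod_cast hN
  have hNη : 1 ≤ η * N := by
    have h1 : (1 / η : ℝ) ≤ N := (Nat.le_ceil _).trans (by exact_mod_cast (by omega))
    rwa [div_le_iff₀ hη0, mul_comm] at h1
  set y : ℝ := (N : ℝ) ^ α with hy
  have hy0 : 0 < y := by positivity
  have hy1 : 1 ≤ y := Real.one_le_rpow hN1 hα0.le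
  have hyN : y ≤ N := by
    calc y ≤ (N : ℝ) ^ (1 : ℝ) := Real.rpow_le_rpow_of_exponent_le hN1 hα1
      _ = N := Real.rpow_one _
  have hyk : y ^ (k + 1) = (N : ℝ) ^ 2 := by
    rw [hy, ← Real.rpow_natCast, ← Real.rpow_mul hN0.le, hα]
    push_cast
    rw [div_mul_cancel₀ _ (by positivity)]
    exact Real.rpow_two _
  have hz1 : 1 ≤ η * N ^ 2 / y := by
    rw [le_div_iff₀ hy0, one_mul]
    nlinarith
  set m := ⌊η * (N : ℝ) ^ 2 / y⌋₊ with hm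
  have hm1 : 1 ≤ m := Nat.le_floor (by simpa using hz1)
  have hm_le : (m : ℝ) ≤ η * N ^ 2 / y := Nat.floor_le (by positivity)
  have hm_ge : η * N ^ 2 / y / 2 ≤ m := by
    have h1 := Nat.lt_floor_add_one (η * (N : ℝ) ^ 2 / y)
    have h2 : (1 : ℝ) ≤ m := by exact_mod_cast hm1
    rw [← hm] at h1
    linarith
  have hm0 : (0 : ℝ) < m := by exact_mod_cast hm1
  set s : ℝ := √(m * ((N * N : ℕ) : ℝ)⁻¹) with hs
  have hsm : s ^ 2 = m * ((N * N : ℕ) : ℝ)⁻¹ := Real.sq_sqrt (by positivity)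
  have hs0 : 0 < s := by
    rw [hs]
    refine Real.sqrt_pos.2 (mul_pos hm0 (inv_pos.2 ?_))
    push_cast
    positivity
  have hs_le : s ^ 2 ≤ η / y := by
    rw [hsm]
    push_cast
    rw [← div_eq_mul_inv, div_le_iff₀ (by positivity)]
    calc (m : ℝ) ≤ η * N ^ 2 / y := hm_le
      _ = _ := by ring
  have hs_ge : η / 2 / y ≤ s ^ 2 := by
    rw [hsm]
    push_cast
    rw [← div_eq_mul_inv, le_div_iff₀ (by positivity)]
    calc _ = η * N ^ 2 / y / 2 := by ring
      _ ≤ (m : ℝ) := hm_ge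
  have hxsq : (N * s ^ (k + 1)) ^ 2 = y ^ (k + 1) * (s ^ 2) ^ (k + 1) := by
    rw [hyk]
    ring
  have hx_le : N * s ^ (k + 1) ≤ η := by
    refine le_of_sq_le_sq ?_ hη0.le
    calc (N * s ^ (k + 1)) ^ 2 ≤ y ^ (k + 1) * (η / y) ^ (k + 1) := by
          rw [hxsq]
          gcongr
      _ = η ^ (k + 1) := by
          rw [← mul_pow, mul_div_cancel₀ _ hy0.ne']
      _ ≤ η ^ 2 := pow_le_pow_of_le_one hη0.le hη1 (by omega)
  -- `κ` bounds the square from below, and the quantity itself is at most 1, hence at least its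
  -- square.
  have hx_ge : κ ≤ N * s ^ (k + 1) := by
    calc κ = y ^ (k + 1) * (η / 2 / y) ^ (k + 1) := by
          rw [← mul_pow, mul_div_cancel₀ _ hy0.ne']
      _ ≤ (N * s ^ (k + 1)) ^ 2 := by
          rw [hxsq]
          gcongr
      _ ≤ N * s ^ (k + 1) := pow_le_of_le_one (by positivity) (hx_le.trans hη1) (by norm_num)
  have hny : (n : ℝ) ^ α ≤ 2 * k * y := by
    have h1 : (n : ℝ) ≤ 2 * k * N := by
      have h2 : k * N + n % k = n := Nat.div_add_mod n k
      have h3 := Nat.mod_lt n (show 0 < k by omega)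
      have h4 : k * 1 ≤ k * N := Nat.mul_le_mul_left _ hN
      have : n ≤ 2 * k * N := by
        rw [mul_assoc, two_mul]
        omega
      exact_mod_cast this
    calc (n : ℝ) ^ α ≤ (2 * k * N : ℝ) ^ α := by gcongr
      _ = (2 * k : ℝ) ^ α * y := Real.mul_rpow (by positivity) hN0.le
      _ ≤ (2 * k : ℝ) ^ (1 : ℝ) * y := by
          have : (1 : ℝ) ≤ 2 * k := by
            exact_mod_cast (by omega : 1 ≤ 2 * k)
          gcongr
      _ = 2 * k * y := by rw [Real.rpow_one]
  have hsη : s ^ 2 ≤ η := hs_le.trans (div_le_self hη0.le hy1)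
  refine tournamentGameMakersWin_of_sparse hT hV hk hN (Nat.mul_div_le n k) hs0 hsm hη1 hsη hx_le
    ?_ ?_
  · rw [hη, mul_div_cancel₀ _ (by positivity)]
  · have hb' : (1 : ℝ) ≤ b := by exact_mod_cast hb1
    calc 2 * (E : ℝ) ^ 2 * s ^ 2 * (b + 1) ≤ 2 * (E : ℝ) ^ 2 * (η / y) *
          (2 * (κ ^ (k - 2) / (16 * k * E ^ 2 * η) * (2 * k * y))) := by
          gcongr
          calc (b : ℝ) + 1 ≤ 2 * b := by linarith
            _ ≤ 2 * (κ ^ (k - 2) / (16 * k * E ^ 2 * η) * (n : ℝ) ^ α) := by gcongr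
            _ ≤ _ := by gcongr
      _ = κ ^ (k - 2) / 2 := by
          field_simp
          norm_num
      _ < κ ^ (k - 2) := half_lt_self (by positivity)
      _ ≤ _ := by gcongr

end MakerBias

/-! ### Thresholds and conclusion -/

section Threshold

/-- The threshold requires wins at all smaller positive biases, so a single lost bias bounds it and
no monotonicity in the bias is needed. -/
lemma exists_isThresholdBias {win : ℕ → Prop} {B : ℕ} (hB : 1 ≤ B) (h : ¬ win B) :
    ∃ t, IsThresholdBias win t ∧ t < B := by
  set S : Set ℕ := {s : ℕ | ∀ b : ℕ, 1 ≤ b → b ≤ s → win b} with hS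
  have hlt : ∀ s ∈ S, s < B := by
    intro s hs
    by_contra! hle
    exact h (hs B hB hle)
  have hne : S.Nonempty := ⟨0, fun b h1 h0 => by omega⟩
  have hbdd : BddAbove S := ⟨B, fun s hs => (hlt s hs).le⟩
  exact ⟨sSup S, ⟨Nat.sSup_mem hne hbdd, fun s hs => le_csSup hbdd hs⟩,
    hlt _ (Nat.sSup_mem hne hbdd)⟩

lemma IsThresholdBias.mono {win win' : ℕ → Prop} {t t' : ℕ} (h : IsThresholdBias win t)
    (h' : IsThresholdBias win' t') (hw : ∀ b, win b → win' b) : t ≤ t' :=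
  h'.2 fun b h1 h2 => hw b (h.1 b h1 h2)

lemma IsThresholdBias.lt_of_not {win : ℕ → Prop} {t B : ℕ} (h : IsThresholdBias win t)
    (hB : 1 ≤ B) (hw : ¬ win B) : t < B := by
  by_contra! hle
  exact hw (h.1 B hB hle)

lemma TournamentGameMakersWin.clique {V : Type*} [Fintype V] {T : Digraph V}
    (hT : T.IsTournament) {n b : ℕ} (h : TournamentGameMakersWin T n b) :
    CliqueGameMakersWin (Fintype.card V) n b := by
  have := MakerWinsFrom.image (goal' := fun M : Finset (Sym2 (Fin n)) =>
    ¬ (SimpleGraph.fromEdgeSet (M : Set (Sym2 (Fin n)))).CliqueFree (Fintype.card V)) ?_ h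
  · simpa [CliqueGameMakersWin, IsMakersWin] using this
  · rintro M ⟨f, hf⟩ hfree
    refine hfree (Finset.univ.map f) ⟨?_, by simp⟩
    intro x hx y hy hxy
    simp only [Finset.coe_map, Finset.coe_univ, Set.image_univ, Set.mem_range] at hx hy
    obtain ⟨u, rfl⟩ := hx
    obtain ⟨v, rfl⟩ := hy
    have huv : u ≠ v := fun h => hxy (h ▸ rfl)
    rw [SimpleGraph.fromEdgeSet_adj]
    refine ⟨Finset.mem_coe.2 (Finset.mem_image.2 ?_), hxy⟩
    rcases hT.2 u v huv with ⟨h, _⟩ | ⟨h, _⟩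
    · exact ⟨_, hf u v h, rfl⟩
    · exact ⟨_, hf v u h, Sym2.eq_swap⟩

lemma exists_bias_not_cliqueGameMakersWin {k : ℕ} (hk : 3 ≤ k) :
    (∀ n, ∃ b, 1 ≤ b ∧ ¬ CliqueGameMakersWin k n b) ∧
    ∃ C : ℝ, 0 < C ∧ ∃ n₀ : ℕ, ∀ n, n₀ ≤ n → ∃ b : ℕ, 1 ≤ b ∧
      (b : ℝ) ≤ C * (n : ℝ) ^ ((2 : ℝ) / ((k : ℝ) + 1)) ∧ ¬ CliqueGameMakersWin k n b := by
  obtain ⟨q₀, hq₀⟩ := exists_not_cliqueGameMakersWin hk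
  set c : ℝ := 1 / (4 * (k : ℝ) ^ 2) with hc
  have hk0 : (0 : ℝ) < k := by exact_mod_cast (by omega : 0 < k)
  have hk1 : (1 : ℝ) ≤ k := by exact_mod_cast (by omega : 1 ≤ k)
  have hc0 : 0 < c := by positivity
  have hc1 : c ≤ 1 := by
    rw [hc, div_le_one (by positivity)]
    nlinarith
  set α : ℝ := (2 : ℝ) / ((k : ℝ) + 1) with hα
  have hα0 : 0 < α := by positivity
  have key : ∀ n q : ℕ, q₀ ≤ q → (n : ℝ) ^ α / c ≤ q → ¬ CliqueGameMakersWin k n (2 * q) := by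
    intro n q hq hnq
    refine hq₀ n q hq ?_
    have h1 : (n : ℝ) ^ α ≤ c * (1 + q) := by
      rw [div_le_iff₀ hc0] at hnq
      nlinarith
    have h2 : ((n : ℝ) ^ α) ^ (k + 1) = (n : ℝ) ^ 2 := by
      rw [← Real.rpow_natCast, ← Real.rpow_mul (by positivity), hα]
      push_cast
      rw [div_mul_cancel₀ _ (by positivity)]
      exact Real.rpow_two _
    calc (n : ℝ) ^ 2 = ((n : ℝ) ^ α) ^ (k + 1) := h2.symm
      _ ≤ (c * (1 + q)) ^ (k + 1) := by gcongr
      _ = c ^ (k + 1) * (1 + (q : ℝ)) ^ (k + 1) := mul_pow _ _ _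
      _ ≤ c ^ 2 * (1 + (q : ℝ)) ^ (k + 1) := by
          refine mul_le_mul_of_nonneg_right ?_ (by positivity)
          exact pow_le_pow_of_le_one hc0.le hc1 (by omega)
  constructor
  · intro n
    set q := max (q₀ + 1) ⌈(n : ℝ) ^ α / c⌉₊ with hq
    refine ⟨2 * q, by omega, key n q (by omega) ((Nat.le_ceil _).trans ?_)⟩
    exact_mod_cast le_max_right _ _
  · have htend : Tendsto (fun n : ℕ => (n : ℝ) ^ α) atTop atTop :=
      (tendsto_rpow_atTop hα0).comp tendsto_natCast_atTop_atTop
    obtain ⟨n₀, hn₀⟩ := eventually_atTop.1 (htend.eventually_ge_atTop ((q₀ : ℝ) + 1))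
    -- One factor 2 comes from the bias `2 * q`, the other from rounding up, as `n ^ α / c ≥ 1`.
    refine ⟨4 / c, by positivity, n₀, fun n hn => ?_⟩
    have h1 := hn₀ n hn
    have h0 : (0 : ℝ) ≤ q₀ := by positivity
    have h2 : (n : ℝ) ^ α ≤ (n : ℝ) ^ α / c := by
      rw [le_div_iff₀ hc0]
      exact mul_le_of_le_one_right (by positivity) hc1
    set q := ⌈(n : ℝ) ^ α / c⌉₊ with hq
    have h3 : (n : ℝ) ^ α / c ≤ q := Nat.le_ceil _
    have h4 : (q : ℝ) < (n : ℝ) ^ α / c + 1 := Nat.ceil_lt_add_one (by positivity)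
    have h5 : q₀ + 1 ≤ q := by
      have : (q₀ : ℝ) + 1 ≤ q := by linarith
      exact_mod_cast this
    refine ⟨2 * q, by omega, ?_, key n q (by omega) h3⟩
    push_cast
    have h6 : 4 / c * (n : ℝ) ^ α = 4 * ((n : ℝ) ^ α / c) := by ring
    rw [h6]
    linarith

end Threshold

theorem proposition1 {V : Type*} [Fintype V] (T : Digraph V) (hT : T.IsTournament)
    (k : ℕ) (hk : Fintype.card V = k) (hk3 : 3 ≤ k) :
    ∃ bT bK : ℕ → ℕ,
      (∀ n, IsThresholdBias (TournamentGameMakersWin T n) (bT n)) ∧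
      (∀ n, IsThresholdBias (CliqueGameMakersWin k n) (bK n)) ∧
      (fun n : ℕ => (bT n : ℝ)) =Θ[atTop] (fun n : ℕ => (n : ℝ) ^ ((2 : ℝ) / ((k : ℝ) + 1))) ∧
      (fun n : ℕ => (bT n : ℝ)) =Θ[atTop] (fun n : ℕ => (bK n : ℝ)) := by
  obtain ⟨hbdd, C, hC, n₁, hn₁⟩ := exists_bias_not_cliqueGameMakersWin hk3
  obtain ⟨c, hc, n₀, hn₀⟩ := exists_tournamentGameMakersWin hT hk hk3
  have himp : ∀ n b, TournamentGameMakersWin T n b → CliqueGameMakersWin k n b :=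
    fun n b h => hk ▸ h.clique hT
  have hK : ∀ n, ∃ t, IsThresholdBias (CliqueGameMakersWin k n) t := by
    intro n
    obtain ⟨b, hb, hw⟩ := hbdd n
    exact (exists_isThresholdBias hb hw).imp fun t ht => ht.1
  have hTb : ∀ n, ∃ t, IsThresholdBias (TournamentGameMakersWin T n) t := by
    intro n
    obtain ⟨b, hb, hw⟩ := hbdd n
    exact (exists_isThresholdBias hb fun h => hw (himp n b h)).imp fun t ht => ht.1
  choose bK hbK using hK
  choose bT hbT using hTb
  set α : ℝ := (2 : ℝ) / ((k : ℝ) + 1) with hα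
  have hα0 : 0 < α := by positivity
  -- The chain n^α ≲ `bT` ≤ `bK` ≲ n^α yields both Θ-statements.
  have hle : ∀ n, bT n ≤ bK n := fun n => (hbT n).mono (hbK n) (himp n)
  have hupper : ∀ n, n₁ ≤ n → (bK n : ℝ) ≤ C * (n : ℝ) ^ α := by
    intro n hn
    obtain ⟨b, hb, hbC, hw⟩ := hn₁ n hn
    refine le_trans ?_ hbC
    exact_mod_cast ((hbK n).lt_of_not hb hw).le
  have hlower : ∀ᶠ n : ℕ in atTop, c / 2 * (n : ℝ) ^ α ≤ bT n := by
    have htend : Tendsto (fun n : ℕ => (n : ℝ) ^ α) atTop atTop :=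
      (tendsto_rpow_atTop hα0).comp tendsto_natCast_atTop_atTop
    filter_upwards [eventually_ge_atTop n₀, htend.eventually_ge_atTop (2 / c)] with n hn hn2
    have h1 : ⌊c * (n : ℝ) ^ α⌋₊ ≤ bT n := (hbT n).2 fun b hb1 hb2 =>
      hn₀ n b hn hb1 ((Nat.le_floor_iff (by positivity)).1 hb2)
    have h2 : c * (n : ℝ) ^ α < ⌊c * (n : ℝ) ^ α⌋₊ + 1 := Nat.lt_floor_add_one _
    have h3 : (⌊c * (n : ℝ) ^ α⌋₊ : ℝ) ≤ bT n := by exact_mod_cast h1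
    rw [div_le_iff₀ hc] at hn2
    linarith
  have hTn : (fun n : ℕ => (n : ℝ) ^ α) =O[atTop] fun n : ℕ => (bT n : ℝ) := by
    refine IsBigO.of_bound (2 / c) ?_
    filter_upwards [hlower] with n hn
    rw [Real.norm_of_nonneg (by positivity), Real.norm_of_nonneg (by positivity)]
    calc (n : ℝ) ^ α = 2 / c * (c / 2 * (n : ℝ) ^ α) := by field_simp
      _ ≤ _ := by gcongr
  have hKn : (fun n : ℕ => (bK n : ℝ)) =O[atTop] fun n : ℕ => (n : ℝ) ^ α := by
    refine IsBigO.of_bound C ?_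
    filter_upwards [eventually_ge_atTop n₁] with n hn
    rw [Real.norm_of_nonneg (by positivity), Real.norm_of_nonneg (by positivity)]
    exact hupper n hn
  have hTK : (fun n : ℕ => (bT n : ℝ)) =O[atTop] fun n : ℕ => (bK n : ℝ) :=
    IsBigO.of_bound 1 (Eventually.of_forall fun n => by simpa using hle n)
  exact ⟨bT, bK, hbT, hbK, ⟨hTK.trans hKn, hTn⟩, hTK, hKn.trans hTn⟩
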